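/- **Proposition 5.3 (Concentration for the volume).** Let $d\ge 1$ and $k\in\{0,1,\dots,d-1\}$ be integers, let $e_1,\dots,e_d$ be the standard basis of $\mathbb{R}^d$, let $E_k=\operatorname{span}(e_{d-k+1},\dots,e_d)$, and identify $\mathbb{R}^{d-k}$ with $\operatorname{span}(e_1,\dots,e_{d-k})$. Let $\mathrm{SO}_{d,k}\subset \mathrm{SO}(d)$ be the set that contains, for each $k$-dimensional linear subspace $L$ of $\mathbb{R}^d$, the lexicographically smallest $\theta\in \mathrm{SO}(d)$ with $\theta E_k=L$. Let $\mathcal{C}'_{n}$ be the space of non-empty compact subsets of $\mathbb{R}^{n}$ with the Hausdorff metric, and let $\ell_n$ be Lebesgue measure on $\mathbb{R}^n$. Let $\mathbb{Q}$ be a Borel probability measure on $\mathbb{M}_{d,k}=\mathrm{SO}_{d,k}\times\mathcal{C}'_{d-k}$, let $\gamma\in(0,\infty)$, and let $\eta$ be a Poisson process on $\mathbb{R}^{d-k}\times\mathbb{M}_{d,k}$ with intensity measure $\gamma\,\ell_{d-k}\otimes\mathbb{Q}$, that is, a random $\sigma$-finite counting measure, defined on a probability space with probability measure $\mathbb{P}$.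 The Poisson cylinder model is $$Z=\bigcup_{(x,\theta,K)\in\eta}Z(x,\theta,K),\qquad Z(x,\theta,K)=\theta\big((x+K)\times E_k\big).$$ Suppose that the typical cylinder base $\Xi$, a random set whose distribution is the marginal of $\mathbb{Q}$ on $\mathcal{C}'_{d-k}$, satisfies $\ell_{d-k}(\Xi)\le A$ almost surely for some $A<\infty$. Let $W\subset\mathbb{R}^d$ be non-empty and compact and let $F=\ell_d(Z\cap W)$. Then $F$ is $\mathbb{P}$-integrable and, with $$\kappa=\frac{\sqrt e}{2(\sqrt e-1)},\qquad c=\frac{\log 2}{8\kappa},$$ one has for every $t\ge 4\sqrt{\kappa}$ that $$\mathbb{P}(F\ge\mathbb{E}[F]+t)\le\exp\Big\{-\frac{c\,t^2}{A\,\operatorname{diam}(W)^k\,\ell_d(W)}\Big\},\qquad \mathbb{P}(F\le\mathbb{E}[F]-t)\le\exp\Big\{-\frac{c\,t^2}{\gamma\,A^2\,\operatorname{diam}(W)^k\,\ell_d(W)}\Big\}.$$ Here $\operatorname{diam}(W)^0=1$, and if a denominator is zero, the right-hand side is read as $\exp(-\infty)=0$. -/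

import Mathlib

open MeasureTheory TopologicalSpace
open scoped ENNReal

namespace PoissonCylinder

noncomputable section

/-! Poisson processes on a measurable space. -/

section PoissonProcess

variable {Ω X : Type*} [MeasurableSpace Ω] [MeasurableSpace X]

/-- A `σ`-finite counting measure: a `σ`-finite measure with values in `{0, 1, 2, …} ∪ {∞}`. -/
structure IsCountingMeasure (ξ : Measure X) : Prop where
  sigmaFinite : SigmaFinite ξ
  integer_valued : ∀ B : Set X, MeasurableSet B → ∃ n : ℕ∞, ξ B = (n : ℝ≥0∞)

/-- `η` is a Poisson process on `X` with intensity measure `μ`, defined on the probability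
space `(Ω, P)`: a measurable map into the `σ`-finite counting measures (with the `σ`-field
generated by the evaluations at measurable sets) such that `η(B)` is Poisson distributed with
mean `μ(B)` (almost surely infinite if `μ(B) = ∞`) and the values on finitely many pairwise
disjoint measurable sets are independent. -/
structure IsPoissonProcess (P : Measure Ω) (μ : Measure X) (η : Ω → Measure X) : Prop where
  measurable : Measurable η
  counting : ∀ ω, IsCountingMeasure (η ω)
  law_of_finite : ∀ B : Set X, MeasurableSet B → μ B ≠ ∞ →
    P.map (fun ω => η ω B) =
      (ProbabilityTheory.poissonMeasure (μ B).toNNReal).map (fun n : ℕ => (n : ℝ≥0∞))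
  law_of_infinite : ∀ B : Set X, MeasurableSet B → μ B = ∞ → ∀ᵐ ω ∂P, η ω B = ∞
  indep : ∀ (n : ℕ) (B : Fin n → Set X), (∀ i, MeasurableSet (B i)) →
    Pairwise (fun i j => Disjoint (B i) (B j)) →
    ProbabilityTheory.iIndepFun (fun i ω => η ω (B i)) P

/-- The points of a counting measure, that is, its atoms. -/
def points (ξ : Measure X) : Set X := {z | 0 < ξ {z}}

end PoissonProcess

/-! Directions and bases of cylinders. -/

/-- Non-empty compact sets carry the Borel `σ`-field of the Hausdorff metric. -/
instance instMeasurableSpaceNonemptyCompacts (E : Type*) [TopologicalSpace E] :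
    MeasurableSpace (NonemptyCompacts E) := borel _

instance instBorelSpaceNonemptyCompacts (E : Type*) [TopologicalSpace E] :
    BorelSpace (NonemptyCompacts E) := ⟨rfl⟩

/-- `E_k`, the span of the last `k` standard basis vectors of `ℝ^d`. -/
def lastSubspace (d k : ℕ) : Submodule ℝ (EuclideanSpace ℝ (Fin d)) :=
  Submodule.span ℝ {v | ∃ i : Fin d, d - k ≤ (i : ℕ) ∧ v = EuclideanSpace.single i 1}

/-- The rotations `M ∈ SO(d)` with `M E_k = L`. -/
def rotationsOnto (d k : ℕ) (L : Submodule ℝ (EuclideanSpace ℝ (Fin d))) :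
    Set (Matrix (Fin d) (Fin d) ℝ) :=
  {M | M ∈ Matrix.specialOrthogonalGroup (Fin d) ℝ ∧
    (lastSubspace d k).map (Matrix.toEuclideanLin M) = L}

/-- The entries of a matrix, read row by row, as an element of a lexicographic order. -/
def lexEntries {d : ℕ} (M : Matrix (Fin d) (Fin d) ℝ) : Lex (Fin d → Lex (Fin d → ℝ)) :=
  toLex fun i => toLex (M i)

/-- `SO_{d,k}`: for each `k`-dimensional linear subspace `L` of `ℝ^d`, the lexicographically
smallest rotation that maps `E_k` onto `L`. -/
def directions (d k : ℕ) : Set (Matrix (Fin d) (Fin d) ℝ) :=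
  {θ | ∃ L : Submodule ℝ (EuclideanSpace ℝ (Fin d)), Module.finrank ℝ L = k ∧
    θ ∈ rotationsOnto d k L ∧ ∀ M ∈ rotationsOnto d k L, lexEntries θ ≤ lexEntries M}

instance instMeasurableSpaceDirections (d k : ℕ) : MeasurableSpace (directions d k) := borel _

instance instBorelSpaceDirections (d k : ℕ) : BorelSpace (directions d k) := ⟨rfl⟩

/-- The space `ℝ^{d-k}` that contains the bases of the cylinders. -/
abbrev BaseSpace (d k : ℕ) : Type := EuclideanSpace ℝ (Fin (d - k))

/-- The mark space `𝕄_{d,k}` of pairs of a direction and a base. -/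
abbrev MarkSpace (d k : ℕ) : Type := directions d k × NonemptyCompacts (BaseSpace d k)

/-! The cylinder model. -/

/-- The first `d - k` coordinates of a vector of `ℝ^d`. -/
def baseCoords (d k : ℕ) (v : EuclideanSpace ℝ (Fin d)) : BaseSpace d k :=
  WithLp.toLp 2 fun i : Fin (d - k) => v (Fin.castLE (Nat.sub_le d k) i)

/-- The cylinder `Z(x, θ, K) = θ((x + K) × E_k)`. -/
def cylinderAt (d k : ℕ) (z : BaseSpace d k × MarkSpace d k) : Set (EuclideanSpace ℝ (Fin d)) :=
  Matrix.toEuclideanLin (z.2.1 : Matrix (Fin d) (Fin d) ℝ) ''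
    {v | ∃ y ∈ (z.2.2 : Set (BaseSpace d k)), baseCoords d k v = z.1 + y}

/-- The union of all cylinders that belong to the points of `ξ`. -/
def cylinderUnion (d k : ℕ) (ξ : Measure (BaseSpace d k × MarkSpace d k)) :
    Set (EuclideanSpace ℝ (Fin d)) :=
  ⋃ z ∈ points ξ, cylinderAt d k z

/-- The intensity measure `γ ℓ_{d-k} ⊗ Q`. -/
def intensity (d k : ℕ) (γ : ℝ) (Q : Measure (MarkSpace d k)) :
    Measure (BaseSpace d k × MarkSpace d k) :=
  ENNReal.ofReal γ • (volume : Measure (BaseSpace d k)).prod Q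

/-- `F = ℓ_d(Z ∩ W)`, the volume of the cylinder model observed in the window `W`. -/
def coveredVolume (d k : ℕ) {Ω : Type*} (η : Ω → Measure (BaseSpace d k × MarkSpace d k))
    (W : NonemptyCompacts (EuclideanSpace ℝ (Fin d))) (ω : Ω) : ℝ :=
  volume.real (cylinderUnion d k (η ω) ∩ (W : Set (EuclideanSpace ℝ (Fin d))))

/-- `κ = √e / (2 (√e - 1))`. -/
def kappa : ℝ := √(Real.exp 1) / (2 * (√(Real.exp 1) - 1))

/-- `c = log 2 / (8 κ)`. -/
def tailConst : ℝ := Real.log 2 / (8 * kappa)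

end

end PoissonCylinder

open PoissonCylinder

open PoissonCylinder
-- Let `ν` be Lebesgue measure on `W` and `C z` the cylinder of the point `z`, so that `F` is the
-- `ν`-measure of the union of `C z` over the points of `η`. Almost every cylinder has `ν (C z) ≤ b
-- = A * diam W ^ k`, so one more point raises `F` by at most `b`. For `G = F` or `G = -F`, the
-- covariance of `G` and `exp (s G)` is at most `b` times the mean total effect of single points on
-- `exp (s G)`. If this is at most `s V E[exp (s G)]`, then `log E[exp (s G)]` has derivative at
-- most `E[G] + s V`; integrating and applying Chernoff's bound gives the tail `exp (-t² / (2V))`,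
-- which is stronger than the claim because `tailConst ≤ 1/2`.
--
-- The two signs give different `V`. For `F`, deleting a point loses only what that point alone
-- covers; these parts are disjoint, so the losses sum to at most `ν(W)`, and `V = b ν(W)`. For
-- `-F`, a point contributes at most `ν (C z)`, whose integral against the intensity is at most `γ A
-- ν(W)`, and `V = b γ A ν(W)`.
--
-- All this is done for finitely many independent Bernoulli variables (`bernoulliSum_covariance_le`,
-- `bernoulliSum_exp_le`) and transferred: `z ↦ 1_{C z}` is a measurable map into `L¹(ν)`, so simple
-- functions reduce `F` to the union of finitely many fixed sets, each present when its cell is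
-- charged. These events are independent, the mean error is controlled by Campbell's formula
-- (`IsPoissonProcess.bind_eq`), and dominated convergence gives `IsPoissonProcess.coverage_mgf_le`.
namespace PoissonCylinder

/-! ### Covariances and exponential moments for independent Bernoulli variables. -/

section BernoulliSums

variable {ι : Type*} [DecidableEq ι]

/-- The expectation of `f` at the random subset of `T` that contains each `i ∈ T` independently
with probability `p i`. -/
def bernoulliSum (p : ι → ℝ) (T : Finset ι) (f : Finset ι → ℝ) : ℝ :=
  ∑ S ∈ T.powerset, (∏ i ∈ S, p i) * (∏ i ∈ T \ S, (1 - p i)) * f S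

variable {p : ι → ℝ} {T : Finset ι} {f g : Finset ι → ℝ}

lemma bernoulliSum_empty : bernoulliSum p ∅ f = f ∅ := by
  simp [bernoulliSum]

/-- Conditioning on the coordinate `a`; this recursion drives the inductions over `T`. -/
lemma bernoulliSum_insert {a : ι} (ha : a ∉ T) :
    bernoulliSum p (insert a T) f =
      bernoulliSum p T (fun S => p a * f (insert a S) + (1 - p a) * f S) := by
  unfold bernoulliSum
  rw [Finset.sum_powerset_insert ha, ← Finset.sum_add_distrib]
  refine Finset.sum_congr rfl fun S hS => ?_
  have hST := Finset.mem_powerset.1 hS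
  have haS : a ∉ S := fun h => ha (hST h)
  rw [Finset.insert_sdiff_of_notMem _ haS,
    Finset.prod_insert (fun h => ha (Finset.mem_sdiff.1 h).1), Finset.prod_insert haS,
    Finset.insert_sdiff_insert, Finset.sdiff_insert_of_notMem ha]
  ring

lemma bernoulliSum_add :
    bernoulliSum p T (fun S => f S + g S) = bernoulliSum p T f + bernoulliSum p T g := by
  simp [bernoulliSum, mul_add, Finset.sum_add_distrib]

lemma bernoulliSum_const_mul (c : ℝ) :
    bernoulliSum p T (fun S => c * f S) = c * bernoulliSum p T f := by
  simp only [bernoulliSum, Finset.mul_sum]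
  exact Finset.sum_congr rfl fun S _ => by ring

lemma bernoulliSum_finset_sum {κ : Type*} (s : Finset κ) (h : κ → Finset ι → ℝ) :
    bernoulliSum p T (fun S => ∑ j ∈ s, h j S) = ∑ j ∈ s, bernoulliSum p T (h j) := by
  simp only [bernoulliSum, Finset.mul_sum]
  exact Finset.sum_comm

lemma bernoulliSum_mono (hp0 : ∀ i, 0 ≤ p i) (hp1 : ∀ i, p i ≤ 1)
    (h : ∀ S ⊆ T, f S ≤ g S) : bernoulliSum p T f ≤ bernoulliSum p T g := by
  refine Finset.sum_le_sum fun S hS => ?_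
  refine mul_le_mul_of_nonneg_left (h S (Finset.mem_powerset.1 hS)) ?_
  exact mul_nonneg (Finset.prod_nonneg fun i _ => hp0 i)
    (Finset.prod_nonneg fun i _ => sub_nonneg.2 (hp1 i))

lemma bernoulliSum_congr (h : ∀ S ⊆ T, f S = g S) : bernoulliSum p T f = bernoulliSum p T g :=
  Finset.sum_congr rfl fun S hS => by rw [h S (Finset.mem_powerset.1 hS)]

lemma bernoulliSum_const (c : ℝ) : bernoulliSum p T (fun _ => c) = c := by
  induction T using Finset.induction_on with
  | empty => simp [bernoulliSum_empty]
  | insert a T ha ih =>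
    rw [bernoulliSum_insert ha]
    refine (bernoulliSum_congr fun S _ => ?_).trans ih
    ring

/-- Averaging over one coordinate that `f` does not depend on. -/
lemma bernoulliSum_mem_mul {i : ι} (hi : i ∈ T) (h : ∀ S, f (insert i S) = f S) :
    bernoulliSum p T (fun S => if i ∈ S then f S else 0) = p i * bernoulliSum p T f := by
  obtain ⟨T, hiT, rfl⟩ : ∃ T', i ∉ T' ∧ insert i T' = T :=
    ⟨T.erase i, Finset.notMem_erase _ _, Finset.insert_erase hi⟩
  rw [bernoulliSum_insert hiT, bernoulliSum_insert hiT, ← bernoulliSum_const_mul]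
  refine bernoulliSum_congr fun S hS => ?_
  have : i ∉ S := fun h => hiT (hS h)
  rw [if_pos (Finset.mem_insert_self i S), if_neg this, h]
  ring

lemma bernoulliSum_notMem_mul {i : ι} (hi : i ∈ T) (h : ∀ S, f (insert i S) = f S) :
    bernoulliSum p T (fun S => if i ∈ S then 0 else f S) = (1 - p i) * bernoulliSum p T f := by
  have h1 := bernoulliSum_mem_mul (p := p) hi h
  have h2 : bernoulliSum p T f = bernoulliSum p T (fun S => if i ∈ S then f S else 0) +
      bernoulliSum p T (fun S => if i ∈ S then 0 else f S) := by
    rw [← bernoulliSum_add]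
    exact bernoulliSum_congr fun S _ => by split_ifs <;> simp
  linarith

/-- A covariance inequality for functions of independent Bernoulli variables. -/
lemma bernoulliSum_covariance_le (hp0 : ∀ i, 0 ≤ p i) (hp1 : ∀ i, p i ≤ 1) {b : ℝ}
    (hf : ∀ i S, |f (insert i S) - f S| ≤ b) :
    bernoulliSum p T (fun S => f S * g S) - bernoulliSum p T f * bernoulliSum p T g ≤
      b * ∑ i ∈ T, p i * (1 - p i) *
        bernoulliSum p T (fun S => |g (insert i S) - g (S.erase i)|) := by
  induction T using Finset.induction_on generalizing f g with
  | empty => simp [bernoulliSum_empty]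
  | insert a T ha ih =>
    have hb : 0 ≤ b := (abs_nonneg _).trans (hf a ∅)
    have h0 := hp0 a
    have h1 := sub_nonneg.2 (hp1 a)
    rw [Finset.sum_insert ha]
    set f' : Finset ι → ℝ := fun S => p a * f (insert a S) + (1 - p a) * f S with hf'
    set g' : Finset ι → ℝ := fun S => p a * g (insert a S) + (1 - p a) * g S with hg'
    have key := ih (f := f') (g := g') (fun i S => by
      have e : f' (insert i S) - f' S = p a * (f (insert i (insert a S)) - f (insert a S)) +
          (1 - p a) * (f (insert i S) - f S) := by
        simp only [hf', Finset.insert_comm i a]; ring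
      rw [e]
      refine (abs_add_le _ _).trans ?_
      rw [abs_mul, abs_mul, abs_of_nonneg h0, abs_of_nonneg h1]
      nlinarith [hf i (insert a S), hf i S])
    -- Law of total covariance: averaging out `a` leaves the covariance of `f'` and `g'`, plus the
    -- mean conditional covariance given the other coordinates.
    have e1 : bernoulliSum p (insert a T) (fun S => f S * g S) =
        bernoulliSum p T (fun S => f' S * g' S) + p a * (1 - p a) *
          bernoulliSum p T (fun S => (f (insert a S) - f S) * (g (insert a S) - g S)) := by
      rw [bernoulliSum_insert ha, ← bernoulliSum_const_mul, ← bernoulliSum_add]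
      refine bernoulliSum_congr fun S _ => ?_
      simp only [hf', hg']; ring
    rw [e1, bernoulliSum_insert ha (f := f), bernoulliSum_insert ha (f := g)]
    have e2 : bernoulliSum p T (fun S => (f (insert a S) - f S) * (g (insert a S) - g S)) ≤
        b * bernoulliSum p (insert a T) (fun S => |g (insert a S) - g (S.erase a)|) := by
      rw [bernoulliSum_insert ha, ← bernoulliSum_const_mul]
      refine bernoulliSum_mono hp0 hp1 fun S hS => ?_
      have haS : a ∉ S := fun h => ha (hS h)
      rw [Finset.insert_idem, Finset.erase_insert haS, Finset.erase_eq_of_notMem haS]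
      calc _ ≤ |f (insert a S) - f S| * |g (insert a S) - g S| := by
            rw [← abs_mul]; exact le_abs_self _
        _ ≤ b * |g (insert a S) - g S| := mul_le_mul_of_nonneg_right (hf a S) (abs_nonneg _)
        _ = _ := by ring
    -- By the triangle inequality, averaging over `a` does not increase the mean increments in the
    -- other coordinates.
    have e3 : ∀ i ∈ T, bernoulliSum p T (fun S => |g' (insert i S) - g' (S.erase i)|) ≤
        bernoulliSum p (insert a T) (fun S => |g (insert i S) - g (S.erase i)|) := by
      intro i hi
      have hia : i ≠ a := fun h => ha (h ▸ hi)
      rw [bernoulliSum_insert ha]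
      refine bernoulliSum_mono hp0 hp1 fun S _ => ?_
      have e : g' (insert i S) - g' (S.erase i) =
          p a * (g (insert i (insert a S)) - g ((insert a S).erase i)) +
          (1 - p a) * (g (insert i S) - g (S.erase i)) := by
        simp only [hg', Finset.insert_comm i a, Finset.erase_insert_of_ne hia.symm]; ring
      rw [e]
      refine (abs_add_le _ _).trans ?_
      rw [abs_mul, abs_mul, abs_of_nonneg h0, abs_of_nonneg h1]
    have e4 : ∑ i ∈ T, p i * (1 - p i) *
          bernoulliSum p T (fun S => |g' (insert i S) - g' (S.erase i)|) ≤
        ∑ i ∈ T, p i * (1 - p i) *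
          bernoulliSum p (insert a T) (fun S => |g (insert i S) - g (S.erase i)|) :=
      Finset.sum_le_sum fun i hi => mul_le_mul_of_nonneg_left (e3 i hi)
        (mul_nonneg (hp0 i) (sub_nonneg.2 (hp1 i)))
    have e5 := mul_le_mul_of_nonneg_left e4 hb
    have e6 := mul_le_mul_of_nonneg_left e2 (mul_nonneg h0 h1)
    rw [mul_add]
    linarith

/-- The entropy method in differential form: a bound for the covariance of `f` and `exp (s f)`
gives a bound for the moment generating function of `f`. -/
lemma bernoulliSum_exp_le (V : ℝ)
    (h : ∀ s : ℝ, 0 ≤ s → bernoulliSum p T (fun S => f S * Real.exp (s * f S)) -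
      bernoulliSum p T f * bernoulliSum p T (fun S => Real.exp (s * f S)) ≤
        s * V * bernoulliSum p T (fun S => Real.exp (s * f S))) {s : ℝ} (hs : 0 ≤ s) :
    bernoulliSum p T (fun S => Real.exp (s * f S)) ≤
      Real.exp (s * bernoulliSum p T f + s ^ 2 * V / 2) := by
  set m := bernoulliSum p T f
  set H : ℝ → ℝ := fun s => bernoulliSum p T (fun S => Real.exp (s * f S)) with hH
  set H' : ℝ → ℝ := fun s => bernoulliSum p T (fun S => f S * Real.exp (s * f S))
  have hd : ∀ s, HasDerivAt H (H' s) s := by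
    intro s
    simp only [hH, bernoulliSum]
    refine HasDerivAt.fun_sum fun S _ => ?_
    refine ((((hasDerivAt_id s).mul_const (f S)).exp).const_mul
      ((∏ i ∈ S, p i) * (∏ i ∈ T \ S, (1 - p i)))).congr_deriv ?_
    simp only [id]
    ring
  have hd2 : ∀ s, HasDerivAt (fun s => H s * Real.exp (-(s * m + s ^ 2 * V / 2)))
      ((H' s - (m + s * V) * H s) * Real.exp (-(s * m + s ^ 2 * V / 2))) s := by
    intro s
    have h1 : HasDerivAt (fun s : ℝ => -(s * m + s ^ 2 * V / 2)) (-(m + s * V)) s := by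
      refine (((hasDerivAt_id s).mul_const m).add
        ((((hasDerivAt_id s).pow 2).mul_const V).div_const 2)).neg.congr_deriv ?_
      simp only [id]
      norm_num
      ring
    refine ((hd s).mul h1.exp).congr_deriv ?_
    ring
  -- The hypothesis says `H' ≤ (m + s V) H`, so the quotient of `H` by the Gaussian bound decreases
  -- from its value 1 at `s = 0`.
  have hanti : AntitoneOn (fun s => H s * Real.exp (-(s * m + s ^ 2 * V / 2))) (Set.Ici 0) := by
    refine antitoneOn_of_deriv_nonpos (convex_Ici 0)
      (fun x _ => (hd2 x).continuousAt.continuousWithinAt)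
      (fun x _ => (hd2 x).differentiableAt.differentiableWithinAt) fun x hx => ?_
    rw [interior_Ici] at hx
    rw [(hd2 x).deriv]
    refine mul_nonpos_of_nonpos_of_nonneg ?_ (Real.exp_pos _).le
    have := h x (le_of_lt hx)
    simp only [hH, H']
    linarith
  have h0 := hanti (Set.mem_Ici.2 le_rfl) (Set.mem_Ici.2 hs) hs
  have hH0 : H 0 = 1 := by simp [hH, bernoulliSum_const]
  simp only [hH0] at h0
  rw [Real.exp_neg, ← div_eq_mul_inv, div_le_iff₀ (Real.exp_pos _)] at h0
  simpa using h0

end BernoulliSums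

/-! ### Exponential moments of the measure of a random union. -/

section RandomUnions

variable {ι E : Type*} [MeasurableSpace E]

/-- The measure of the union of the sets `A i` with `i ∈ S`. -/
def unionMeasure (ν : Measure E) (A : ι → Set E) (S : Finset ι) : ℝ := ν.real (⋃ i ∈ S, A i)

variable {ν : Measure E} {A : ι → Set E} {p : ι → ℝ} {T : Finset ι}

lemma unionMeasure_insert_le [DecidableEq ι] (i : ι) (S : Finset ι) :
    unionMeasure ν A (insert i S) ≤ unionMeasure ν A S + ν.real (A i) := by
  unfold unionMeasure
  rw [Finset.set_biUnion_insert, Set.union_comm]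
  exact measureReal_union_le _ _

variable [IsFiniteMeasure ν]

lemma unionMeasure_le_univ (S : Finset ι) : unionMeasure ν A S ≤ ν.real Set.univ :=
  measureReal_mono (Set.subset_univ _)

lemma unionMeasure_mono {S S' : Finset ι} (h : S ⊆ S') :
    unionMeasure ν A S ≤ unionMeasure ν A S' :=
  measureReal_mono (Set.biUnion_subset_biUnion_left h) (measure_ne_top _ _)

variable [DecidableEq ι]

lemma abs_unionMeasure_insert_sub_le (i : ι) (S : Finset ι) :
    |unionMeasure ν A (insert i S) - unionMeasure ν A S| ≤ ν.real (A i) := by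
  rw [abs_of_nonneg (sub_nonneg.2 (unionMeasure_mono (Finset.subset_insert i S)))]
  linarith [unionMeasure_insert_le (ν := ν) (A := A) i S]

/-- The sum of the measures of the parts that are covered exactly once is at most the measure of
the union. -/
lemma sum_unionMeasure_sub_erase_le (hA : ∀ i, MeasurableSet (A i)) (S : Finset ι) :
    ∑ i ∈ S, (unionMeasure ν A S - unionMeasure ν A (S.erase i)) ≤ unionMeasure ν A S := by
  have hm : ∀ S : Finset ι, MeasurableSet (⋃ i ∈ S, A i) :=
    fun S => Finset.measurableSet_biUnion S fun i _ => hA i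
  have h1 : ∀ i ∈ S, unionMeasure ν A S - unionMeasure ν A (S.erase i) =
      ν.real ((⋃ j ∈ S, A j) \ ⋃ j ∈ S.erase i, A j) := fun i _ =>
    (measureReal_sdiff (Set.biUnion_subset_biUnion_left (S.erase_subset i)) (hm _)
      (measure_ne_top _ _)).symm
  rw [Finset.sum_congr rfl h1, ← measureReal_biUnion_finset]
  · exact measureReal_mono (Set.iUnion₂_subset fun i _ => Set.sdiff_subset) (measure_ne_top _ _)
  · intro i hi j hj hij
    refine Set.disjoint_left.2 fun x hx hx' => ?_
    obtain ⟨l, hl, hxl⟩ := Set.mem_iUnion₂.1 hx.1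
    have hli : l = i := by
      by_contra h
      exact hx.2 (Set.mem_iUnion₂.2 ⟨l, Finset.mem_erase.2 ⟨h, hl⟩, hxl⟩)
    exact hx'.2 (Set.mem_iUnion₂.2 ⟨l, Finset.mem_erase.2 ⟨hli ▸ hij, hl⟩, hxl⟩)
  · exact fun i _ => (hm _).diff (hm _)

/-- Bound for the moment generating function of the measure of a random union at positive
arguments. -/
lemma bernoulliSum_exp_unionMeasure_le (hp0 : ∀ i, 0 ≤ p i) (hp1 : ∀ i, p i ≤ 1)
    (hA : ∀ i, MeasurableSet (A i)) {b : ℝ} (hb0 : 0 ≤ b) (hb : ∀ i, ν.real (A i) ≤ b) {s : ℝ}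
    (hs : 0 ≤ s) :
    bernoulliSum p T (fun S => Real.exp (s * unionMeasure ν A S)) ≤
      Real.exp (s * bernoulliSum p T (unionMeasure ν A) +
        s ^ 2 * (b * ν.real Set.univ) / 2) := by
  refine bernoulliSum_exp_le _ (fun s hs => ?_) hs
  set f := unionMeasure ν A with hf
  refine (bernoulliSum_covariance_le hp0 hp1
    (fun i S => (abs_unionMeasure_insert_sub_le i S).trans (hb i))).trans ?_
  -- The increment does not depend on whether `i ∈ S`, so the factor `p i` becomes the restriction
  -- to `i ∈ S`; the factor `1 - p i` is dropped.
  have h1 : ∀ i ∈ T, p i * (1 - p i) * bernoulliSum p T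
      (fun S => |Real.exp (s * f (insert i S)) - Real.exp (s * f (S.erase i))|) ≤
      bernoulliSum p T (fun S => if i ∈ S then
        |Real.exp (s * f (insert i S)) - Real.exp (s * f (S.erase i))| else 0) := by
    intro i hi
    rw [bernoulliSum_mem_mul hi (fun S => by rw [Finset.insert_idem, Finset.erase_insert_eq_erase])]
    refine mul_le_mul_of_nonneg_right (mul_le_of_le_one_right (hp0 i) (by linarith [hp0 i])) ?_
    rw [← bernoulliSum_const (p := p) (T := T) 0]
    exact bernoulliSum_mono hp0 hp1 fun S _ => abs_nonneg _
  refine (mul_le_mul_of_nonneg_left (Finset.sum_le_sum h1) hb0).trans ?_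
  rw [← bernoulliSum_finset_sum, ← bernoulliSum_const_mul, ← bernoulliSum_const_mul]
  refine bernoulliSum_mono hp0 hp1 fun S hST => ?_
  -- Uses `exp x - exp y ≤ exp x * (x - y)`, which keeps the factor `exp (s * f S)` common to all
  -- `i`.
  have h2 : ∑ i ∈ T, (if i ∈ S then
      |Real.exp (s * f (insert i S)) - Real.exp (s * f (S.erase i))| else 0) ≤
      ∑ i ∈ S, s * Real.exp (s * f S) * (f S - f (S.erase i)) := by
    rw [Finset.sum_ite_mem, Finset.inter_eq_right.2 hST]
    refine Finset.sum_le_sum fun i hi => ?_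
    have hle : f (S.erase i) ≤ f S := unionMeasure_mono (S.erase_subset i)
    rw [Finset.insert_eq_of_mem hi, abs_of_nonneg (sub_nonneg.2 (Real.exp_le_exp.2
      (mul_le_mul_of_nonneg_left hle hs)))]
    have h3 := Real.add_one_le_exp (s * f (S.erase i) - s * f S)
    have h4 : Real.exp (s * f (S.erase i)) =
        Real.exp (s * f S) * Real.exp (s * f (S.erase i) - s * f S) := by
      rw [← Real.exp_add]; ring_nf
    rw [h4]
    nlinarith [mul_le_mul_of_nonneg_left h3 (Real.exp_pos (s * f S)).le]
  rw [← Finset.mul_sum] at h2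
  have h5 : ∑ i ∈ S, (f S - f (S.erase i)) ≤ ν.real Set.univ :=
    (sum_unionMeasure_sub_erase_le hA S).trans (unionMeasure_le_univ S)
  calc _ ≤ b * (s * Real.exp (s * f S) * ν.real Set.univ) :=
        mul_le_mul_of_nonneg_left (h2.trans (mul_le_mul_of_nonneg_left h5
          (mul_nonneg hs (Real.exp_pos _).le))) hb0
    _ = _ := by ring

/-- Bound for the moment generating function of the measure of a random union at negative
arguments. -/
lemma bernoulliSum_exp_neg_unionMeasure_le (hp0 : ∀ i, 0 ≤ p i) (hp1 : ∀ i, p i ≤ 1)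
    {b : ℝ} (hb0 : 0 ≤ b) (hb : ∀ i, ν.real (A i) ≤ b) {s : ℝ} (hs : 0 ≤ s) :
    bernoulliSum p T (fun S => Real.exp (s * -unionMeasure ν A S)) ≤
      Real.exp (s * bernoulliSum p T (fun S => -unionMeasure ν A S) +
        s ^ 2 * (b * ∑ i ∈ T, p i * ν.real (A i)) / 2) := by
  refine bernoulliSum_exp_le (f := fun S => -unionMeasure ν A S) _ (fun s hs => ?_) hs
  set f := unionMeasure ν A with hf
  refine (bernoulliSum_covariance_le hp0 hp1
    (fun i S => by
      rw [neg_sub_neg, abs_sub_comm]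
      exact (abs_unionMeasure_insert_sub_le i S).trans (hb i))).trans ?_
  have h1 : ∀ i ∈ T, p i * (1 - p i) * bernoulliSum p T
      (fun S => |Real.exp (s * -f (insert i S)) - Real.exp (s * -f (S.erase i))|) ≤
      s * (p i * ν.real (A i)) * bernoulliSum p T (fun S => Real.exp (s * -f S)) := by
    intro i hi
    have e1 : bernoulliSum p T
        (fun S => |Real.exp (s * -f (insert i S)) - Real.exp (s * -f (S.erase i))|) ≤
        s * ν.real (A i) * bernoulliSum p T (fun S => Real.exp (s * -f (S.erase i))) := by
      rw [← bernoulliSum_const_mul]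
      refine bernoulliSum_mono hp0 hp1 fun S _ => ?_
      have hins : insert i S = insert i (S.erase i) := by
        ext j; by_cases h : j = i <;> simp [h]
      have h2 : f (S.erase i) ≤ f (insert i S) :=
        unionMeasure_mono ((S.erase_subset i).trans (Finset.subset_insert i S))
      have h3 : f (insert i S) ≤ f (S.erase i) + ν.real (A i) := by
        rw [hins]; exact unionMeasure_insert_le i _
      rw [abs_sub_comm, abs_of_nonneg (sub_nonneg.2 (Real.exp_le_exp.2
        (mul_le_mul_of_nonneg_left (neg_le_neg h2) hs)))]
      have h4 := Real.add_one_le_exp (s * f (S.erase i) - s * f (insert i S))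
      have h5 : Real.exp (s * -f (insert i S)) = Real.exp (s * -f (S.erase i)) *
          Real.exp (s * f (S.erase i) - s * f (insert i S)) := by
        rw [← Real.exp_add]; ring_nf
      rw [h5]
      have h6 := mul_le_mul_of_nonneg_left h3 hs
      have h7 : 1 - Real.exp (s * f (S.erase i) - s * f (insert i S)) ≤ s * ν.real (A i) := by
        linarith
      nlinarith [mul_le_mul_of_nonneg_left h7 (Real.exp_pos (s * -f (S.erase i))).le]
    -- Here `1 - p i` is needed: it restricts the mean to `i ∉ S`, where `S.erase i = S`.
    have e2 : (1 - p i) * bernoulliSum p T (fun S => Real.exp (s * -f (S.erase i))) ≤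
        bernoulliSum p T (fun S => Real.exp (s * -f S)) := by
      rw [← bernoulliSum_notMem_mul hi (fun S => by rw [Finset.erase_insert_eq_erase])]
      refine bernoulliSum_mono hp0 hp1 fun S _ => ?_
      split_ifs with h
      · exact (Real.exp_pos _).le
      · rw [Finset.erase_eq_of_notMem h]
    have hq : 0 ≤ 1 - p i := sub_nonneg.2 (hp1 i)
    calc _ ≤ p i * (1 - p i) *
          (s * ν.real (A i) * bernoulliSum p T (fun S => Real.exp (s * -f (S.erase i)))) :=
          mul_le_mul_of_nonneg_left e1 (mul_nonneg (hp0 i) hq)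
      _ = s * (p i * ν.real (A i)) *
          ((1 - p i) * bernoulliSum p T (fun S => Real.exp (s * -f (S.erase i)))) := by ring
      _ ≤ _ := mul_le_mul_of_nonneg_left e2
          (mul_nonneg hs (mul_nonneg (hp0 i) measureReal_nonneg))
  refine (mul_le_mul_of_nonneg_left (Finset.sum_le_sum h1) hb0).trans (le_of_eq ?_)
  rw [← Finset.sum_mul, ← Finset.mul_sum]
  ring

end RandomUnions

/-! ### Atoms of counting measures. -/

section CountingMeasures

variable {X : Type*} [MeasurableSpace X] {ξ : Measure X}

/-- If every measurable set cuts off a null part of `B` or contains it up to a null set, then `B`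
contains an atom. -/
lemma exists_atom_of_trichotomy [MeasurableSpace.CountablySeparated X] {B : Set X}
    (hB : MeasurableSet B) (hB0 : ξ B ≠ 0)
    (h : ∀ U, MeasurableSet U → ξ (B ∩ U) = 0 ∨ ξ (B \ U) = 0) : ∃ z ∈ B, 0 < ξ {z} := by
  have hne : B.Nonempty := nonempty_of_measure_ne_zero hB0
  have : HasCountableSeparatingOn X MeasurableSet B :=
    (MeasurableSpace.CountablySeparated.countably_separated (α := X)).mono (fun _ h => h)
      (Set.subset_univ B)
  -- The filter of sets of full measure in `B` decides every measurable set, and countably many of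
  -- these separate points, so the filter contains a singleton.
  obtain ⟨z, hz, hzl⟩ :=
    Filter.exists_mem_singleton_mem_of_mem_of_nonempty_of_forall_separating
      (l := ae (ξ.restrict B)) MeasurableSet (s := B) (ae_restrict_mem hB) hne
      (fun U hU => by
        rcases h U hU with h | h
        · right
          rw [mem_ae_iff, compl_compl, Measure.restrict_apply hU, Set.inter_comm]
          exact h
        · left
          rw [mem_ae_iff, Measure.restrict_apply hU.compl, Set.inter_comm]
          exact h)
  refine ⟨z, hz, pos_iff_ne_zero.2 fun h0 => hB0 ?_⟩
  have h1 : ξ.restrict B {z}ᶜ = 0 := mem_ae_iff.1 hzl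
  have h2 : ξ.restrict B {z} = 0 := le_antisymm
    ((Measure.restrict_le_self _).trans h0.le) zero_le
  have h3 : ξ.restrict B Set.univ = 0 := by
    rw [← Set.union_compl_self {z}]
    exact measure_union_null h2 h1
  simpa using h3

/-- By σ-finiteness, `B` has a charged subset of finite integer mass. If it splits into two charged
parts, one part has smaller integer mass and induction applies; if it never splits, it contains an
atom. -/
lemma IsCountingMeasure.exists_point [MeasurableSpace.CountablySeparated X]
    (hξ : IsCountingMeasure ξ) {B : Set X} (hB : MeasurableSet B) (hB0 : ξ B ≠ 0) :
    ∃ z ∈ B, z ∈ points ξ := by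
  have := hξ.sigmaFinite
  obtain ⟨C, hCB, hC, hC0, hCtop⟩ :
      ∃ C ⊆ B, MeasurableSet C ∧ ξ C ≠ 0 ∧ ξ C ≠ ∞ := by
    obtain ⟨C, hC, hCB, h1, h2⟩ := Measure.exists_subset_measure_lt_top hB (pos_iff_ne_zero.2 hB0)
    exact ⟨C, hCB, hC, h1.ne', h2.ne⟩
  suffices H : ∀ (n : ℕ) (C : Set X), MeasurableSet C → ξ C = n → ξ C ≠ 0 →
      ∃ z ∈ C, 0 < ξ {z} by
    obtain ⟨n, hn⟩ := hξ.integer_valued C hC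
    have hnt : n ≠ ⊤ := by rintro rfl; simp_all
    lift n to ℕ using hnt
    obtain ⟨z, hz, hz'⟩ := H n C hC (by simpa using hn) hC0
    exact ⟨z, hCB hz, hz'⟩
  intro n
  induction n using Nat.strong_induction_on with
  | _ n ih =>
    intro C hC hn hC0
    by_cases h : ∀ U, MeasurableSet U → ξ (C ∩ U) = 0 ∨ ξ (C \ U) = 0
    · exact exists_atom_of_trichotomy hC hC0 h
    · push Not at h
      obtain ⟨U, hU, h1, h2⟩ := h
      have hadd := measure_inter_add_sdiff (μ := ξ) C hU
      have hlt : ξ (C ∩ U) < ξ C := by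
        rw [← hadd]
        refine ENNReal.lt_add_right ?_ h2
        exact measure_ne_top_of_subset Set.inter_subset_left (by rw [hn]; simp)
      obtain ⟨m, hm⟩ := hξ.integer_valued _ (hC.inter hU)
      have hmt : m ≠ ⊤ := by rintro rfl; simp_all
      lift m to ℕ using hmt
      have hmn : m < n := by
        rw [hm, hn] at hlt
        exact_mod_cast hlt
      obtain ⟨z, hz, hz'⟩ := ih m hmn (C ∩ U) (hC.inter hU) (by simpa using hm) h1
      exact ⟨z, hz.1, hz'⟩

variable [MeasurableSingletonClass X]

lemma IsCountingMeasure.one_le_of_mem_points (hξ : IsCountingMeasure ξ) {z : X}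
    (hz : z ∈ points ξ) : 1 ≤ ξ {z} := by
  obtain ⟨n, hn⟩ := hξ.integer_valued {z} (measurableSet_singleton z)
  have h0 : 0 < ξ {z} := hz
  rw [hn] at h0 ⊢
  have h1 : 0 < n := by exact_mod_cast h0
  exact_mod_cast Order.one_le_iff_pos.2 h1

lemma IsCountingMeasure.countable_points (hξ : IsCountingMeasure ξ) : (points ξ).Countable := by
  have := hξ.sigmaFinite
  exact Measure.countable_meas_pos_of_disjoint_iUnion (μ := ξ) (As := fun z : X => {z})
    (fun z => measurableSet_singleton z)
    (fun _ _ h => Set.disjoint_singleton.2 h)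

/-- Every atom has mass at least 1. Multiplicities are discarded, since they do not affect unions.
-/
lemma IsCountingMeasure.tsum_points_le (hξ : IsCountingMeasure ξ) (g : X → ℝ≥0∞) :
    ∑' z : points ξ, g z ≤ ∫⁻ z, g z ∂ξ := by
  refine le_trans ?_ (setLIntegral_le_lintegral (points ξ) g)
  rw [lintegral_countable _ hξ.countable_points]
  exact ENNReal.tsum_le_tsum fun z => le_mul_of_one_le_right' (hξ.one_le_of_mem_points z.2)

end CountingMeasures

/-! ### Campbell's formula for the mean measure. -/

section Campbell

variable {Ω X : Type*} [MeasurableSpace Ω] [MeasurableSpace X] {P : Measure Ω} {μ : Measure X}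
  {η : Ω → Measure X}

lemma lintegral_natCast_poissonMeasure (r : NNReal) :
    ∫⁻ n : ℕ, (n : ℝ≥0∞) ∂ProbabilityTheory.poissonMeasure r = r := by
  have h1 : HasSum (fun n : ℕ => (Real.exp (-r) * (r : ℝ) ^ n / n.factorial) * n) r := by
    have h2 := (ProbabilityTheory.hasSum_one_poissonMeasure r).mul_left (r : ℝ)
    rw [mul_one] at h2
    rw [← hasSum_nat_add_iff' 1]
    simp only [Finset.range_one, Finset.sum_singleton, Nat.cast_zero, mul_zero, sub_zero]
    refine h2.congr_fun fun n => ?_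
    rw [Nat.factorial_succ]
    push_cast
    field_simp
    ring
  rw [lintegral_countable']
  have h3 : ∀ n : ℕ, (n : ℝ≥0∞) * ProbabilityTheory.poissonMeasure r {n} =
      ENNReal.ofReal ((Real.exp (-r) * (r : ℝ) ^ n / n.factorial) * n) := by
    intro n
    rw [ProbabilityTheory.poissonMeasure_singleton, mul_comm (Real.exp _ * _ / _),
      ENNReal.ofReal_mul (by positivity), ENNReal.ofReal_natCast]
  simp_rw [h3]
  rw [← ENNReal.ofReal_tsum_of_nonneg (fun n => by positivity) h1.summable, h1.tsum_eq]
  simp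

lemma IsPoissonProcess.bind_eq [IsProbabilityMeasure P] (hη : IsPoissonProcess P μ η) :
    P.bind η = μ := by
  ext B hB
  rw [Measure.bind_apply hB hη.measurable.aemeasurable]
  by_cases h : μ B = ∞
  · rw [lintegral_congr_ae (hη.law_of_infinite B hB h), h]
    simp
  · have hm : Measurable fun ω => η ω B := (Measure.measurable_coe hB).comp hη.measurable
    calc ∫⁻ ω, η ω B ∂P = ∫⁻ x, x ∂(P.map fun ω => η ω B) := (lintegral_map measurable_id hm).symm
      _ = μ B := by
        rw [hη.law_of_finite B hB h, lintegral_map (f := fun x => x) measurable_id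
          (measurable_of_countable _), lintegral_natCast_poissonMeasure]
        exact ENNReal.coe_toNNReal h

end Campbell

/-! ### Approximating a measurable family of sets by finitely many sets. -/

section Approximation

variable {X E : Type*} [MeasurableSpace X] [MeasurableSpace E]

lemma measurable_of_measurable_edist {Y : Type*} [PseudoEMetricSpace Y]
    [SecondCountableTopology Y] [MeasurableSpace Y] [BorelSpace Y] {f : X → Y}
    (h : ∀ y, Measurable fun x => edist (f x) y) : Measurable f := by
  refine measurable_of_isOpen fun U hU => ?_
  choose! r hr0 hr using EMetric.isOpen_iff.1 hU
  obtain ⟨T, hT, hTU⟩ := TopologicalSpace.isOpen_iUnion_countable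
    (fun y : U => Metric.eball (y : Y) (r y)) fun y => Metric.isOpen_eball
  have hU' : U = ⋃ y ∈ T, Metric.eball (y : Y) (r y) := by
    rw [hTU]
    refine Set.Subset.antisymm (fun y hy => ?_) (Set.iUnion_subset fun y => hr y y.2)
    exact Set.mem_iUnion.2 ⟨⟨y, hy⟩, Metric.mem_eball_self (hr0 y hy)⟩
  rw [hU', Set.preimage_iUnion₂]
  exact MeasurableSet.biUnion hT fun y _ => h y measurableSet_Iio

variable {ν : Measure E} [IsFiniteMeasure ν] {C : X → Set E}

lemma measurableSet_section (hC : MeasurableSet {q : E × X | q.1 ∈ C q.2}) (z : X) :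
    MeasurableSet (C z) := measurable_prodMk_right (y := z) hC

/-- The indicator function of `C z` as an element of `L¹(ν)`. -/
noncomputable def indicatorClass (ν : Measure E) [IsFiniteMeasure ν]
    (hC : MeasurableSet {q : E × X | q.1 ∈ C q.2}) (z : X) : Lp ℝ 1 ν :=
  indicatorConstLp 1 (measurableSet_section hC z) (measure_ne_top ν _) 1

lemma enorm_indicatorConstLp_one {s : Set E} (hs : MeasurableSet s) :
    ‖indicatorConstLp (μ := ν) 1 hs (measure_ne_top ν _) (1 : ℝ)‖ₑ = ν s := by
  rw [← ofReal_norm, norm_indicatorConstLp one_ne_zero ENNReal.one_ne_top]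
  simp

lemma enorm_indicatorClass (hC : MeasurableSet {q : E × X | q.1 ∈ C q.2}) (z : X) :
    ‖indicatorClass ν hC z‖ₑ = ν (C z) := enorm_indicatorConstLp_one _

/-- `L¹(ν)` is separable because `E` is countably generated, so it suffices that the distance to
each fixed `y` is measurable in `z`; that distance is a parameter integral of a jointly measurable
function. -/
lemma measurable_indicatorClass [MeasurableSpace.CountablyGenerated E]
    [MeasurableSpace (Lp ℝ 1 ν)] [BorelSpace (Lp ℝ 1 ν)]
    (hC : MeasurableSet {q : E × X | q.1 ∈ C q.2}) : Measurable (indicatorClass ν hC) := by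
  have : Fact ((1 : ℝ≥0∞) ≠ ∞) := ⟨ENNReal.one_ne_top⟩
  refine measurable_of_measurable_edist fun y => ?_
  have h1 : ∀ z, edist (indicatorClass ν hC z) y =
      ∫⁻ v, ‖({q : E × X | q.1 ∈ C q.2}.indicator (fun _ => (1 : ℝ)) (v, z)) - y v‖ₑ ∂ν := by
    intro z
    rw [Lp.edist_def, eLpNorm_one_eq_lintegral_enorm]
    refine lintegral_congr_ae ?_
    filter_upwards [indicatorConstLp_coeFn (p := 1) (hs := measurableSet_section hC z)
      (hμs := measure_ne_top ν _) (c := (1 : ℝ))] with v hv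
    rw [Pi.sub_apply, indicatorClass, hv]
    rfl
  simp_rw [h1]
  refine Measurable.lintegral_prod_left' (f := fun q : E × X =>
    ‖({q : E × X | q.1 ∈ C q.2}.indicator (fun _ => (1 : ℝ)) q) - y q.1‖ₑ) ?_
  exact ((measurable_const.indicator hC).sub
    ((Lp.stronglyMeasurable y).measurable.comp measurable_fst)).enorm

/-- A measurable family of sets is approximated in measure by families that are constant on the
cells of a finite partition. -/
lemma exists_partition_approx [MeasurableSpace.CountablyGenerated E] {μ : Measure X}
    (hC : MeasurableSet {q : E × X | q.1 ∈ C q.2}) {b : ℝ} (hb0 : 0 ≤ b)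
    (hb : ∀ᵐ z ∂μ, ν.real (C z) ≤ b) (hint : ∫⁻ z, ν (C z) ∂μ ≠ ∞) {ε : ℝ≥0∞} (hε : ε ≠ 0) :
    ∃ (n : ℕ) (B : Fin n → Set X) (A : Fin n → Set E) (g : X → ℝ≥0∞),
      (∀ i, MeasurableSet (B i)) ∧ Pairwise (fun i j => Disjoint (B i) (B j)) ∧
      (∀ z, ∃ i, z ∈ B i) ∧ (∀ i, MeasurableSet (A i)) ∧ (∀ i, ν.real (A i) ≤ b) ∧
      Measurable g ∧ ∫⁻ z, g z ∂μ ≤ ε ∧ ∀ i, ∀ z ∈ B i, ν (symmDiff (C z) (A i)) ≤ g z := by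
  have : Fact ((1 : ℝ≥0∞) ≠ ∞) := ⟨ENNReal.one_ne_top⟩
  let _ : MeasurableSpace (Lp ℝ 1 ν) := borel _
  have : BorelSpace (Lp ℝ 1 ν) := ⟨rfl⟩
  set f := indicatorClass ν hC with hf
  have hfm : Measurable f := measurable_indicatorClass hC
  -- Simple functions with values in `s` take only classes of indicators of genuine sets of measure
  -- at most `b`; the class 0 is the empty set.
  set s : Set (Lp ℝ 1 ν) := insert 0 (f '' {z | ν.real (C z) ≤ b}) with hs
  have h0 : (0 : Lp ℝ 1 ν) ∈ s := Set.mem_insert _ _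
  have hlim := SimpleFunc.tendsto_approxOn_L1_enorm (μ := μ) hfm h0
    (by
      filter_upwards [hb] with z hz
      exact subset_closure (Set.mem_insert_of_mem _ ⟨z, hz, rfl⟩))
    (by
      simp only [HasFiniteIntegral, sub_zero, hf, enorm_indicatorClass]
      exact hint.lt_top)
  obtain ⟨N, hN⟩ := ((hlim.eventually (gt_mem_nhds (pos_iff_ne_zero.2 hε))).exists)
  set φ := SimpleFunc.approxOn f hfm s 0 h0 N with hφ
  set e := φ.range.equivFin
  have hrep : ∀ i, ∃ A : Set E, ∃ hA : MeasurableSet A, ν.real A ≤ b ∧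
      ((e.symm i : Lp ℝ 1 ν)) = indicatorConstLp 1 hA (measure_ne_top ν _) 1 := by
    intro i
    obtain ⟨z, hz⟩ := SimpleFunc.mem_range.1 (e.symm i).2
    have hmem : (e.symm i : Lp ℝ 1 ν) ∈ s := hz ▸ SimpleFunc.approxOn_mem hfm h0 N z
    rcases hmem with h | ⟨z', hz', h⟩
    · refine ⟨∅, MeasurableSet.empty, by simpa using hb0, ?_⟩
      rw [h, indicatorConstLp_empty]
    · exact ⟨C z', measurableSet_section hC z', hz', h.symm⟩
  choose A hA hAb hAe using hrep
  refine ⟨φ.range.card, fun i => φ ⁻¹' {(e.symm i : Lp ℝ 1 ν)}, A, fun z => ‖φ z - f z‖ₑ,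
    fun i => φ.measurableSet_fiber _, ?_, ?_, hA, hAb, ?_, hN.le, ?_⟩
  · intro i j hij
    refine Disjoint.preimage _ (Set.disjoint_singleton.2 fun h => hij ?_)
    exact e.symm.injective (Subtype.ext h)
  · intro z
    exact ⟨e ⟨φ z, φ.mem_range_self z⟩, by simp⟩
  · exact (φ.measurable.sub hfm).enorm
  · intro i z hz
    have hz' : φ z = e.symm i := hz
    change _ ≤ ‖φ z - f z‖ₑ
    rw [hz', hAe, ← edist_eq_enorm_sub, edist_comm, hf, indicatorClass,
      edist_indicatorConstLp_eq_enorm, enorm_indicatorConstLp_one]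

end Approximation

/-! ### The charged cells as a Bernoulli random set. -/

section Coverage

open scoped Classical in
/-- The set of cells that are charged by `ξ`. -/
noncomputable def chargedCells {X : Type*} [MeasurableSpace X] {n : ℕ} (B : Fin n → Set X)
    (ξ : Measure X) : Finset (Fin n) := {i | ξ (B i) ≠ 0}

variable {X E : Type*} [MeasurableSpace X] [MeasurableSpace E] {n : ℕ} {B : Fin n → Set X}

lemma mem_chargedCells {ξ : Measure X} {i : Fin n} : i ∈ chargedCells B ξ ↔ ξ (B i) ≠ 0 := by
  simp [chargedCells]

variable {Ω : Type*} [MeasurableSpace Ω] {P : Measure Ω} {η : Ω → Measure X}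

lemma measurableSet_charged (hη : Measurable η) (hB : ∀ i, MeasurableSet (B i)) (i : Fin n) :
    MeasurableSet {ω | η ω (B i) ≠ 0} :=
  ((Measure.measurable_coe (hB i)).comp hη) (measurableSet_singleton (0 : ℝ≥0∞)).compl

lemma measurableSet_chargedCells_eq (hη : Measurable η) (hB : ∀ i, MeasurableSet (B i))
    (S : Finset (Fin n)) : MeasurableSet {ω | chargedCells B (η ω) = S} := by
  have : {ω | chargedCells B (η ω) = S} =
      ⋂ i, if i ∈ S then {ω | η ω (B i) ≠ 0} else {ω | η ω (B i) ≠ 0}ᶜ := by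
    ext ω
    simp only [Set.mem_ofPred_eq, Finset.ext_iff, mem_chargedCells, Set.mem_iInter]
    refine forall_congr' fun i => ?_
    by_cases h : i ∈ S <;> simp [h]
  rw [this]
  refine MeasurableSet.iInter fun i => ?_
  split_ifs
  · exact measurableSet_charged hη hB i
  · exact (measurableSet_charged hη hB i).compl

lemma measurable_comp_chargedCells (hη : Measurable η) (hB : ∀ i, MeasurableSet (B i))
    (h : Finset (Fin n) → ℝ) : Measurable fun ω => h (chargedCells B (η ω)) := by
  intro U _
  have : (fun ω => h (chargedCells B (η ω))) ⁻¹' U =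
      ⋃ S ∈ {S | h S ∈ U}, {ω | chargedCells B (η ω) = S} := by
    ext ω; simp
  rw [this]
  exact MeasurableSet.biUnion (Set.to_countable _)
    fun S _ => measurableSet_chargedCells_eq hη hB S

/-- If the counts of the cells are independent, then the charged cells are a random subset whose
elements are chosen independently. -/
lemma integral_comp_chargedCells [IsProbabilityMeasure P] (hη : Measurable η)
    (hB : ∀ i, MeasurableSet (B i))
    (hind : ProbabilityTheory.iIndepFun (fun i ω => η ω (B i)) P) (h : Finset (Fin n) → ℝ) :
    ∫ ω, h (chargedCells B (η ω)) ∂P =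
      bernoulliSum (fun i => P.real {ω | η ω (B i) ≠ 0}) Finset.univ h := by
  have h1 : ∀ ω, h (chargedCells B (η ω)) = ∑ S : Finset (Fin n),
      {ω | chargedCells B (η ω) = S}.indicator (fun _ => h S) ω := by
    intro ω
    simp [Set.indicator_apply]
  simp_rw [h1]
  rw [integral_finsetSum _ fun S _ =>
    (integrable_const _).indicator (measurableSet_chargedCells_eq hη hB S)]
  rw [bernoulliSum, Finset.powerset_univ]
  refine Finset.sum_congr rfl fun S _ => ?_
  rw [integral_indicator_const _ (measurableSet_chargedCells_eq hη hB S), smul_eq_mul]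
  congr 1
  set T : Fin n → Set ℝ≥0∞ := fun i => if i ∈ S then {0}ᶜ else {0} with hT
  have h2 := hind.measure_inter_preimage_eq_mul Finset.univ (sets := T) (fun i _ => by
    simp only [hT]; split_ifs
    · exact (measurableSet_singleton _).compl
    · exact measurableSet_singleton _)
  have h3 : {ω | chargedCells B (η ω) = S} =
      ⋂ i ∈ Finset.univ, (fun ω => η ω (B i)) ⁻¹' T i := by
    ext ω
    simp only [Set.mem_ofPred_eq, Finset.ext_iff, mem_chargedCells, Finset.mem_univ,
      Set.iInter_true, Set.mem_iInter, hT, Set.mem_preimage]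
    refine forall_congr' fun i => ?_
    by_cases h : i ∈ S <;> simp [h]
  rw [measureReal_def, h3, h2, ENNReal.toReal_prod,
    ← Finset.prod_sdiff (Finset.subset_univ S), mul_comm]
  congr 1
  · refine Finset.prod_congr rfl fun i hi => ?_
    simp only [hT, if_pos hi]
    rfl
  · refine Finset.prod_congr rfl fun i hi => ?_
    rw [← probReal_compl_eq_one_sub (measurableSet_charged hη hB i)]
    simp only [hT, if_neg (Finset.mem_sdiff.1 hi).2, measureReal_def]
    congr 2
    ext ω
    simp

/-- The measure of the union of the sets `C z` over all points `z` of `ξ`. -/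
noncomputable def coverage (ν : Measure E) (C : X → Set E) (ξ : Measure X) : ℝ :=
  ν.real (⋃ z ∈ points ξ, C z)

variable {ν : Measure E} {C : X → Set E} {A : Fin n → Set E}

variable [IsFiniteMeasure ν]

/-- Each point charges its cell and each charged cell contains a point, so the two unions differ
only inside the sets `symmDiff (C z) (A i)` with `z` a point in the cell `B i`. -/
lemma ofReal_abs_coverage_sub_le [MeasurableSpace.CountablySeparated X] {ξ : Measure X}
    (hξ : IsCountingMeasure ξ) (hC : ∀ z, MeasurableSet (C z))
    (hB : ∀ i, MeasurableSet (B i)) (hdisj : Pairwise fun i j => Disjoint (B i) (B j))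
    (hBcov : ∀ z, ∃ i, z ∈ B i) (hA : ∀ i, MeasurableSet (A i))
    {g : X → ℝ≥0∞} (hg : ∀ i, ∀ z ∈ B i, ν (symmDiff (C z) (A i)) ≤ g z) :
    ENNReal.ofReal |coverage ν C ξ - unionMeasure ν A (chargedCells B ξ)| ≤ ∫⁻ z, g z ∂ξ := by
  have : MeasurableSingletonClass X := MeasurableSpace.measurableSingletonClass_of_countablySeparated
  choose i hi using hBcov
  have hcount := hξ.countable_points
  have : Countable (points ξ) := hcount.to_subtype
  have hsub : symmDiff (⋃ z ∈ points ξ, C z) (⋃ j ∈ chargedCells B ξ, A j) ⊆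
      ⋃ z : points ξ, symmDiff (C z) (A (i z)) := by
    rintro v (⟨hv1, hv2⟩ | ⟨hv1, hv2⟩)
    · obtain ⟨z, hz, hvz⟩ := Set.mem_iUnion₂.1 hv1
      refine Set.mem_iUnion.2 ⟨⟨z, hz⟩, Or.inl ⟨hvz, fun hvA => hv2 ?_⟩⟩
      refine Set.mem_iUnion₂.2 ⟨i z, mem_chargedCells.2 fun h0 => ?_, hvA⟩
      exact (ne_of_gt hz) (measure_mono_null (Set.singleton_subset_iff.2 (hi z)) h0)
    · obtain ⟨j, hj, hvj⟩ := Set.mem_iUnion₂.1 hv1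
      obtain ⟨z, hzB, hz⟩ := hξ.exists_point (hB j) (mem_chargedCells.1 hj)
      have hij : i z = j := by
        by_contra hne
        exact Set.disjoint_left.1 (hdisj hne) (hi z) hzB
      refine Set.mem_iUnion.2 ⟨⟨z, hz⟩, Or.inr ⟨hij ▸ hvj, ?_⟩⟩
      exact fun hvC => hv2 (Set.mem_iUnion₂.2 ⟨z, hz, hvC⟩)
  have h1 := abs_measureReal_sub_le_measureReal_symmDiff (μ := ν)
    (MeasurableSet.biUnion hcount fun z _ => hC z).nullMeasurableSet
    (Finset.measurableSet_biUnion (chargedCells B ξ) fun j _ => hA j).nullMeasurableSet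
  calc _ ≤ ENNReal.ofReal (ν.real (symmDiff (⋃ z ∈ points ξ, C z)
        (⋃ j ∈ chargedCells B ξ, A j))) := ENNReal.ofReal_le_ofReal h1
    _ = ν (symmDiff (⋃ z ∈ points ξ, C z) (⋃ j ∈ chargedCells B ξ, A j)) :=
        ENNReal.ofReal_toReal (measure_ne_top _ _)
    _ ≤ ∑' z : points ξ, ν (symmDiff (C z) (A (i z))) :=
        (measure_mono hsub).trans (measure_iUnion_le _)
    _ ≤ ∑' z : points ξ, g z := ENNReal.tsum_le_tsum fun z => hg _ _ (hi z)
    _ ≤ _ := hξ.tsum_points_le g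

end Coverage

/-! ### Exponential moments of the Poisson coverage. -/

section PoissonCoverage

variable {X E Ω : Type*} [MeasurableSpace X] [MeasurableSpace.CountablySeparated X]
  [MeasurableSpace E] [MeasurableSpace.CountablyGenerated E] [MeasurableSpace Ω]
  {P : Measure Ω} [IsProbabilityMeasure P] {μ : Measure X} {η : Ω → Measure X}
  {ν : Measure E} [IsFiniteMeasure ν] {C : X → Set E} {b : ℝ}

/-- The coverage of a Poisson process is approximated in `L¹` by functions of finitely many
independent events, with uniform bounds for the moment generating functions. -/
lemma IsPoissonProcess.exists_coverage_approx (hη : IsPoissonProcess P μ η)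
    (hC : MeasurableSet {q : E × X | q.1 ∈ C q.2}) (hb0 : 0 ≤ b)
    (hb : ∀ᵐ z ∂μ, ν.real (C z) ≤ b) (hint : ∫⁻ z, ν (C z) ∂μ ≠ ∞) {ε : ℝ≥0∞} (hε : ε ≠ 0)
    (hε' : ε ≠ ∞) :
    ∃ (G : Ω → ℝ) (R : Ω → ℝ≥0∞), Measurable G ∧ Measurable R ∧
      (∀ ω, 0 ≤ G ω) ∧ (∀ ω, G ω ≤ ν.real Set.univ) ∧ ∫⁻ ω, R ω ∂P ≤ ε ∧
      (∀ ω, ENNReal.ofReal |coverage ν C (η ω) - G ω| ≤ R ω) ∧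
      ∀ s : ℝ, 0 ≤ s →
        ∫ ω, Real.exp (s * G ω) ∂P ≤
          Real.exp (s * ∫ ω, G ω ∂P + s ^ 2 * (b * ν.real Set.univ) / 2) ∧
        ∫ ω, Real.exp (s * -G ω) ∂P ≤ Real.exp (s * -∫ ω, G ω ∂P +
          s ^ 2 * (b * ((∫⁻ z, ν (C z) ∂μ).toReal + ε.toReal)) / 2) := by
  obtain ⟨n, B, A, g, hB, hdisj, hcov, hA, hAb, hgm, hg, hgA⟩ :=
    exists_partition_approx hC hb0 hb hint hε
  have hind := hη.indep n B hB hdisj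
  set p : Fin n → ℝ := fun i => P.real {ω | η ω (B i) ≠ 0} with hp
  have hp0 : ∀ i, 0 ≤ p i := fun i => measureReal_nonneg
  have hp1 : ∀ i, p i ≤ 1 := fun i => measureReal_le_one
  have hE := fun h => integral_comp_chargedCells (P := P) hη.measurable hB hind h
  have hbind : ∫⁻ ω, ∫⁻ z, g z ∂η ω ∂P = ∫⁻ z, g z ∂μ := by
    rw [← Measure.lintegral_bind hη.measurable.aemeasurable hgm.aemeasurable, hη.bind_eq]
  -- Markov's inequality: a nonzero count is at least 1, and the mean count is `μ (B i)`.
  have hpμ : ∀ i, ENNReal.ofReal (p i) ≤ μ (B i) := by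
    intro i
    simp only [hp]
    rw [ofReal_measureReal]
    have h1 : μ (B i) = ∫⁻ ω, η ω (B i) ∂P := by
      rw [← Measure.bind_apply (hB i) hη.measurable.aemeasurable, hη.bind_eq]
    rw [h1, ← lintegral_indicator_one (measurableSet_charged hη.measurable hB i)]
    refine lintegral_mono fun ω => ?_
    by_cases hω : ω ∈ {ω | η ω (B i) ≠ 0}
    swap
    · rw [Set.indicator_of_notMem hω]
      exact zero_le
    rw [Set.indicator_of_mem hω]
    obtain ⟨m, hm⟩ := (hη.counting ω).integer_valued (B i) (hB i)
    have hω' : η ω (B i) ≠ 0 := hω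
    rw [hm] at hω' ⊢
    have : 0 < m := pos_iff_ne_zero.2 (by exact_mod_cast hω')
    have h2 : (1 : ℝ≥0∞) ≤ (m : ℝ≥0∞) := by exact_mod_cast Order.one_le_iff_pos.2 this
    exact h2
  have hsum : ∑ i, p i * ν.real (A i) ≤ (∫⁻ z, ν (C z) ∂μ).toReal + ε.toReal := by
    rw [← ENNReal.toReal_add hint hε']
    rw [← ENNReal.ofReal_le_iff_le_toReal (ENNReal.add_ne_top.2 ⟨hint, hε'⟩),
      ENNReal.ofReal_sum_of_nonneg fun i _ => mul_nonneg (hp0 i) measureReal_nonneg]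
    have hCm : Measurable fun z => ν (C z) := measurable_measure_prodMk_right hC
    calc ∑ i, ENNReal.ofReal (p i * ν.real (A i)) ≤ ∑ i, ∫⁻ z in B i, (ν (C z) + g z) ∂μ := by
          refine Finset.sum_le_sum fun i _ => ?_
          rw [ENNReal.ofReal_mul (hp0 i), ofReal_measureReal (μ := ν)]
          calc ENNReal.ofReal (p i) * ν (A i) ≤ μ (B i) * ν (A i) := mul_le_mul_left (hpμ i) _
            _ = ∫⁻ _ in B i, ν (A i) ∂μ := by rw [setLIntegral_const, mul_comm]
            _ ≤ ∫⁻ z in B i, (ν (C z) + g z) ∂μ := by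
              refine setLIntegral_mono' (hB i) fun z hz => ?_
              have h1 : A i ⊆ C z ∪ symmDiff (C z) (A i) := fun v hv => by
                by_cases h : v ∈ C z
                · exact Or.inl h
                · exact Or.inr (Or.inr ⟨hv, h⟩)
              exact (measure_mono h1).trans ((measure_union_le _ _).trans
                (add_le_add_right (hgA i z hz) _))
      _ = ∫⁻ z in ⋃ i, B i, (ν (C z) + g z) ∂μ := by
          rw [lintegral_iUnion hB hdisj, tsum_fintype]
      _ ≤ ∫⁻ z, (ν (C z) + g z) ∂μ := setLIntegral_le_lintegral _ _
      _ = ∫⁻ z, ν (C z) ∂μ + ∫⁻ z, g z ∂μ := lintegral_add_left hCm _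
      _ ≤ _ := add_le_add_right hg _
  refine ⟨fun ω => unionMeasure ν A (chargedCells B (η ω)), fun ω => ∫⁻ z, g z ∂η ω,
    measurable_comp_chargedCells hη.measurable hB _,
    (Measure.measurable_lintegral hgm).comp hη.measurable,
    fun ω => measureReal_nonneg, fun ω => unionMeasure_le_univ _, hbind.trans_le hg,
    fun ω => ofReal_abs_coverage_sub_le (hη.counting ω) (measurableSet_section hC) hB hdisj hcov
      hA hgA, fun s hs => ⟨?_, ?_⟩⟩
  · rw [hE fun S => Real.exp (s * unionMeasure ν A S), hE]
    exact bernoulliSum_exp_unionMeasure_le hp0 hp1 hA hb0 hAb hs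
  · have h1 := hE fun S => -unionMeasure ν A S
    rw [integral_neg] at h1
    rw [hE fun S => Real.exp (s * -unionMeasure ν A S), h1]
    refine (bernoulliSum_exp_neg_unionMeasure_le hp0 hp1 hb0 hAb hs).trans ?_
    gcongr

/-- The coverage of a Poisson process is measurable, and its moment generating function has
Gaussian bounds. -/
theorem IsPoissonProcess.coverage_mgf_le (hη : IsPoissonProcess P μ η)
    (hC : MeasurableSet {q : E × X | q.1 ∈ C q.2}) (hb0 : 0 ≤ b)
    (hb : ∀ᵐ z ∂μ, ν.real (C z) ≤ b) (hint : ∫⁻ z, ν (C z) ∂μ ≠ ∞) :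
    AEMeasurable (fun ω => coverage ν C (η ω)) P ∧ ∀ s : ℝ, 0 ≤ s →
      ∫ ω, Real.exp (s * coverage ν C (η ω)) ∂P ≤
        Real.exp (s * ∫ ω, coverage ν C (η ω) ∂P + s ^ 2 * (b * ν.real Set.univ) / 2) ∧
      ∫ ω, Real.exp (s * -coverage ν C (η ω)) ∂P ≤
        Real.exp (s * -∫ ω, coverage ν C (η ω) ∂P +
          s ^ 2 * (b * (∫⁻ z, ν (C z) ∂μ).toReal) / 2) := by
  -- The errors `2⁻ⁿ` are summable, so `∑ R n` has finite mean and the approximations converge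
  -- almost surely, not only in `L¹`.
  have hε0 : ∀ n : ℕ, ((2 : ℝ≥0∞)⁻¹ ^ n) ≠ 0 := fun n => by simp
  have hεt : ∀ n : ℕ, ((2 : ℝ≥0∞)⁻¹ ^ n) ≠ ∞ := fun n => ENNReal.pow_ne_top (by simp)
  choose G R hG hR hG0 hGv hRint hGR hmgf using
    fun n : ℕ => hη.exists_coverage_approx hC hb0 hb hint (hε0 n) (hεt n)
  have hlim : ∀ᵐ ω ∂P, Filter.Tendsto (fun n => G n ω) Filter.atTop
      (nhds (coverage ν C (η ω))) := by
    have h1 : ∫⁻ ω, ∑' n, R n ω ∂P ≠ ∞ := by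
      rw [lintegral_tsum fun n => (hR n).aemeasurable]
      refine ne_top_of_le_ne_top ?_ (ENNReal.tsum_le_tsum hRint)
      rw [ENNReal.tsum_geometric]
      simp
    filter_upwards [ae_lt_top (Measurable.tsum hR) h1] with ω hω
    have h2 := ENNReal.tendsto_atTop_zero_of_tsum_ne_top hω.ne
    have h3 : Filter.Tendsto (fun n => ENNReal.ofReal |coverage ν C (η ω) - G n ω|)
        Filter.atTop (nhds 0) :=
      tendsto_of_tendsto_of_tendsto_of_le_of_le tendsto_const_nhds h2 (fun _ => zero_le)
        fun n => hGR n ω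
    rw [tendsto_iff_dist_tendsto_zero]
    have h4 := (ENNReal.tendsto_toReal ENNReal.zero_ne_top).comp h3
    refine h4.congr fun n => ?_
    rw [Function.comp_apply, ENNReal.toReal_ofReal (abs_nonneg _), Real.dist_eq, abs_sub_comm]
  have hmeas : AEMeasurable (fun ω => coverage ν C (η ω)) P :=
    aemeasurable_of_tendsto_metrizable_ae' (fun n => (hG n).aemeasurable) hlim
  have hEG : Filter.Tendsto (fun n => ∫ ω, G n ω ∂P) Filter.atTop
      (nhds (∫ ω, coverage ν C (η ω) ∂P)) :=
    tendsto_integral_of_dominated_convergence (fun _ => ν.real Set.univ)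
      (fun n => (hG n).aestronglyMeasurable) (integrable_const _)
      (fun n => Filter.Eventually.of_forall fun ω => by
        rw [Real.norm_eq_abs, abs_of_nonneg (hG0 n ω)]; exact hGv n ω) hlim
  have hexp : ∀ c : ℝ, Filter.Tendsto (fun n => ∫ ω, Real.exp (c * G n ω) ∂P) Filter.atTop
      (nhds (∫ ω, Real.exp (c * coverage ν C (η ω)) ∂P)) := fun c =>
    tendsto_integral_of_dominated_convergence (fun _ => Real.exp (|c| * ν.real Set.univ))
      (fun n => ((hG n).const_mul c).exp.aestronglyMeasurable) (integrable_const _)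
      (fun n => Filter.Eventually.of_forall fun ω => by
        rw [Real.norm_eq_abs, Real.abs_exp]
        exact Real.exp_le_exp.2 (mul_le_mul (le_abs_self c) (hGv n ω) (hG0 n ω) (abs_nonneg c)))
      (hlim.mono fun ω hω => (Real.continuous_exp.tendsto _).comp (hω.const_mul c))
  refine ⟨hmeas, fun s hs => ⟨?_, ?_⟩⟩
  · refine le_of_tendsto_of_tendsto' (hexp s) ?_ fun n => (hmgf n s hs).1
    exact (Real.continuous_exp.tendsto _).comp ((hEG.const_mul s).add_const _)
  · have h1 := hexp (-s)
    simp only [neg_mul, ← mul_neg] at h1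
    refine le_of_tendsto_of_tendsto' h1 ?_ fun n => (hmgf n s hs).2
    refine (Real.continuous_exp.tendsto _).comp ((hEG.neg.const_mul s).add ?_)
    have h2 : Filter.Tendsto (fun n : ℕ => ((2 : ℝ≥0∞)⁻¹ ^ n).toReal) Filter.atTop (nhds 0) := by
      simp only [ENNReal.toReal_pow]
      exact tendsto_pow_atTop_nhds_zero_of_lt_one ENNReal.toReal_nonneg (by norm_num)
    have h3 := (((h2.const_add (∫⁻ z, ν (C z) ∂μ).toReal).const_mul b).const_mul (s ^ 2)).div_const 2
    simpa only [add_zero] using h3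


end PoissonCoverage

/-! ### Tail bounds from exponential moments. -/

section Chernoff

variable {Ω : Type*} [MeasurableSpace Ω] {P : Measure Ω} [IsProbabilityMeasure P] {F : Ω → ℝ}

/-- Chernoff's bound for a bounded random variable with a Gaussian bound for its moment generating
function. -/
lemma measureReal_ge_le_exp_of_mgf_le (hF : AEMeasurable F P) {M : ℝ} (hM : ∀ ω, F ω ≤ M)
    {m V : ℝ}
    (hmgf : ∀ s : ℝ, 0 ≤ s → ∫ ω, Real.exp (s * F ω) ∂P ≤ Real.exp (s * m + s ^ 2 * V / 2))
    (t : ℝ) {s : ℝ} (hs : 0 ≤ s) :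
    P.real {ω | m + t ≤ F ω} ≤ Real.exp (s ^ 2 * V / 2 - s * t) := by
  have hint : Integrable (fun ω => Real.exp (s * F ω)) P := by
    refine Integrable.of_bound (hF.const_mul s).exp.aestronglyMeasurable (Real.exp (s * M))
      (Filter.Eventually.of_forall fun ω => ?_)
    rw [Real.norm_eq_abs, Real.abs_exp]
    exact Real.exp_le_exp.2 (mul_le_mul_of_nonneg_left (hM ω) hs)
  refine (ProbabilityTheory.measure_ge_le_exp_mul_mgf (m + t) hs hint).trans ?_
  refine (mul_le_mul_of_nonneg_left (hmgf s hs) (Real.exp_pos _).le).trans (le_of_eq ?_)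
  rw [← Real.exp_add]
  ring_nf

lemma measureReal_ge_le_exp_of_mgf_le_of_pos (hF : AEMeasurable F P) {M : ℝ} (hM : ∀ ω, F ω ≤ M)
    {m V : ℝ} (hV : 0 < V)
    (hmgf : ∀ s : ℝ, 0 ≤ s → ∫ ω, Real.exp (s * F ω) ∂P ≤ Real.exp (s * m + s ^ 2 * V / 2))
    {t : ℝ} (ht : 0 ≤ t) :
    P.real {ω | m + t ≤ F ω} ≤ Real.exp (-(t ^ 2 / (2 * V))) := by
  -- The choice `s = t / V` minimizes `s² V / 2 - s t`.
  refine (measureReal_ge_le_exp_of_mgf_le hF hM hmgf t (div_nonneg ht hV.le)).trans (le_of_eq ?_)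
  congr 1
  field_simp
  ring

/-- With `V = 0` Chernoff's bound is `exp (-s t)` for every `s ≥ 0`; let `s` tend to infinity. -/
lemma measureReal_ge_eq_zero_of_mgf_le (hF : AEMeasurable F P) {M : ℝ} (hM : ∀ ω, F ω ≤ M)
    {m V : ℝ} (hV : V = 0)
    (hmgf : ∀ s : ℝ, 0 ≤ s → ∫ ω, Real.exp (s * F ω) ∂P ≤ Real.exp (s * m + s ^ 2 * V / 2))
    {t : ℝ} (ht : 0 < t) : P.real {ω | m + t ≤ F ω} = 0 := by
  refine le_antisymm (ge_of_tendsto' (x := Filter.atTop) (f := fun n : ℕ => Real.exp (-(n * t)))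
    ?_ fun n => ?_) measureReal_nonneg
  · exact Real.tendsto_exp_neg_atTop_nhds_zero.comp
      (tendsto_natCast_atTop_atTop.atTop_mul_const ht)
  · refine (measureReal_ge_le_exp_of_mgf_le hF hM hmgf t n.cast_nonneg).trans (le_of_eq ?_)
    rw [hV]
    ring_nf

end Chernoff

/-! ### Measurability and volume of cylinders. -/

section Geometry

instance instSecondCountableTopologyMatrix (d : ℕ) :
    SecondCountableTopology (Matrix (Fin d) (Fin d) ℝ) :=
  inferInstanceAs (SecondCountableTopology (Fin d → Fin d → ℝ))

variable {d k : ℕ}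

lemma transpose_mul_of_mem_directions {θ : Matrix (Fin d) (Fin d) ℝ} (h : θ ∈ directions d k) :
    θ.transpose * θ = 1 := by
  obtain ⟨L, -, ⟨hθ, -⟩, -⟩ := h
  have h1 := (Matrix.mem_unitaryGroup_iff'.1 (Matrix.mem_specialUnitaryGroup_iff.1 hθ).1)
  rwa [Matrix.star_eq_conjTranspose, Matrix.conjTranspose_eq_transpose_of_trivial] at h1

lemma toEuclideanLin_transpose_apply {θ : Matrix (Fin d) (Fin d) ℝ} (h : θ.transpose * θ = 1)
    (v : EuclideanSpace ℝ (Fin d)) :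
    Matrix.toEuclideanLin θ.transpose (Matrix.toEuclideanLin θ v) = v := by
  simp [Matrix.toLpLin_apply, h]

lemma toEuclideanLin_apply_transpose {θ : Matrix (Fin d) (Fin d) ℝ} (h : θ.transpose * θ = 1)
    (v : EuclideanSpace ℝ (Fin d)) :
    Matrix.toEuclideanLin θ (Matrix.toEuclideanLin θ.transpose v) = v := by
  simp [Matrix.toLpLin_apply, mul_eq_one_comm.1 h]

/-- The linear isometry given by an orthogonal matrix. -/
noncomputable def rotationIsometry (θ : Matrix (Fin d) (Fin d) ℝ) (h : θ.transpose * θ = 1) :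
    EuclideanSpace ℝ (Fin d) ≃ₗᵢ[ℝ] EuclideanSpace ℝ (Fin d) where
  toLinearEquiv := LinearEquiv.ofLinearMap (Matrix.toEuclideanLin θ)
    (Matrix.toEuclideanLin θ.transpose)
    (LinearMap.ext fun v => toEuclideanLin_apply_transpose h v)
    (LinearMap.ext fun v => toEuclideanLin_transpose_apply h v)
  norm_map' v := by
    have h1 : ‖Matrix.toEuclideanLin θ v‖ ^ 2 = ‖v‖ ^ 2 := by
      rw [← real_inner_self_eq_norm_sq, ← real_inner_self_eq_norm_sq]
      simp only [EuclideanSpace.inner_eq_star_dotProduct, Matrix.toLpLin_apply, star_trivial]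
      rw [Matrix.dotProduct_mulVec, Matrix.vecMul_mulVec, h, Matrix.vecMul_one]
    exact (pow_left_inj₀ (norm_nonneg _) (norm_nonneg _) two_ne_zero).1 h1

/-- Rotating back by the transpose replaces an image by a condition that is jointly continuous in
the point, shift, direction and base. -/
lemma mem_cylinderAt_iff {z : BaseSpace d k × MarkSpace d k} {v : EuclideanSpace ℝ (Fin d)} :
    v ∈ cylinderAt d k z ↔
      baseCoords d k (Matrix.toEuclideanLin (z.2.1 : Matrix (Fin d) (Fin d) ℝ).transpose v) - z.1 ∈
        (z.2.2 : Set (BaseSpace d k)) := by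
  have hθ := transpose_mul_of_mem_directions z.2.1.2
  constructor
  · rintro ⟨u, ⟨y, hy, hu⟩, rfl⟩
    rwa [toEuclideanLin_transpose_apply hθ, hu, add_sub_cancel_left]
  · intro h
    exact ⟨_, ⟨_, h, (add_sub_cancel _ _).symm⟩, toEuclideanLin_apply_transpose hθ v⟩

/-- Membership means that `Metric.infDist` vanishes, and this is jointly continuous in the point and
the compact set. -/
lemma isClosed_mem_nonemptyCompacts {Y : Type*} [MetricSpace Y] :
    IsClosed {p : Y × NonemptyCompacts Y | p.1 ∈ (p.2 : Set Y)} := by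
  have h : {p : Y × NonemptyCompacts Y | p.1 ∈ (p.2 : Set Y)} =
      {p | Metric.infDist p.1 (p.2 : Set Y) = 0} := by
    ext p
    exact p.2.isCompact.isClosed.mem_iff_infDist_zero p.2.nonempty
  rw [h]
  exact isClosed_eq Metric.lipschitz_infDist.continuous continuous_const

lemma continuous_baseCoords : Continuous (baseCoords d k) := by
  unfold baseCoords
  fun_prop

lemma measurableSet_mem_cylinderAt :
    MeasurableSet {q : EuclideanSpace ℝ (Fin d) × (BaseSpace d k × MarkSpace d k) |
      q.1 ∈ cylinderAt d k q.2} := by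
  simp only [mem_cylinderAt_iff]
  have hc : Continuous fun q : EuclideanSpace ℝ (Fin d) × (BaseSpace d k × MarkSpace d k) =>
      Matrix.toEuclideanLin (q.2.2.1 : Matrix (Fin d) (Fin d) ℝ).transpose q.1 := by
    simp only [Matrix.toLpLin_apply]
    fun_prop
  exact (isClosed_mem_nonemptyCompacts.preimage
    (((continuous_baseCoords.comp hc).sub (continuous_fst.comp continuous_snd)).prodMk
      (continuous_snd.comp (continuous_snd.comp continuous_snd)))).measurableSet

instance instCountablySeparatedBaseMark :
    MeasurableSpace.CountablySeparated (BaseSpace d k × MarkSpace d k) := by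
  infer_instance

/-- The volume of the part of a cylinder over `x + K` that lies in `W`. -/
lemma volume_cylinder_inter_le (hk : k ≤ d) {K : Set (BaseSpace d k)} (hK : MeasurableSet K)
    (x : BaseSpace d k) {W : Set (EuclideanSpace ℝ (Fin d))} (hW : MeasurableSet W) :
    volume {v | v ∈ W ∧ baseCoords d k v - x ∈ K} ≤ volume K * Metric.ediam W ^ k := by
  set D : Set (EuclideanSpace ℝ (Fin d)) := {v | v ∈ W ∧ baseCoords d k v - x ∈ K}
  have hD : MeasurableSet D :=
    hW.inter ((continuous_baseCoords.sub continuous_const).measurable hK)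
  set e : Fin (d - k) ⊕ Fin k ≃ Fin d := finSumFinEquiv.trans (finCongr (Nat.sub_add_cancel hk))
  set Φ : (Fin (d - k) → ℝ) × (Fin k → ℝ) → EuclideanSpace ℝ (Fin d) := fun q =>
    WithLp.toLp 2 (MeasurableEquiv.piCongrLeft (fun _ => ℝ) e
      ((MeasurableEquiv.sumPiEquivProdPi fun _ => ℝ).symm q)) with hΦ
  have hΦm : MeasurePreserving Φ volume volume :=
    (PiLp.volume_preserving_toLp (Fin d)).comp
      ((volume_measurePreserving_piCongrLeft (fun _ => ℝ) e).comp
        (volume_measurePreserving_sumPiEquivProdPi_symm fun _ => ℝ))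
  have hΦl : ∀ q i, Φ q (e (Sum.inl i)) = q.1 i := fun q i =>
    Equiv.piCongrLeft_apply_apply (fun _ => ℝ) e _ _
  have hΦr : ∀ q j, Φ q (e (Sum.inr j)) = q.2 j := fun q j =>
    Equiv.piCongrLeft_apply_apply (fun _ => ℝ) e _ _
  have hbase : ∀ q, baseCoords d k (Φ q) = WithLp.toLp 2 q.1 := by
    intro q
    ext i
    exact hΦl q i
  rw [← hΦm.measure_preimage hD.nullMeasurableSet, Measure.volume_eq_prod,
    Measure.prod_apply (hΦm.measurable hD)]
  have hKm : MeasurableSet {a : Fin (d - k) → ℝ | WithLp.toLp 2 a - x ∈ K} :=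
    ((PiLp.volume_preserving_toLp (Fin (d - k))).measurable.sub_const x) hK
  have hKv : volume {a : Fin (d - k) → ℝ | WithLp.toLp 2 a - x ∈ K} = volume K :=
    ((measurePreserving_sub_right volume x).comp
      (PiLp.volume_preserving_toLp (Fin (d - k)))).measure_preimage hK.nullMeasurableSet
  -- Fubini: the slice over `a` is empty unless `a - x ∈ K`. Its sup-norm diameter is at most the
  -- Euclidean diameter of `W`, so its volume is at most `Metric.ediam W ^ k`.
  calc ∫⁻ a, volume (Prod.mk a ⁻¹' (Φ ⁻¹' D))
      ≤ ∫⁻ a, {a : Fin (d - k) → ℝ | WithLp.toLp 2 a - x ∈ K}.indicator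
          (fun _ => Metric.ediam W ^ k) a := by
        refine lintegral_mono fun a => ?_
        by_cases ha : a ∈ {a : Fin (d - k) → ℝ | WithLp.toLp 2 a - x ∈ K}
        · rw [Set.indicator_of_mem ha]
          refine (Real.volume_pi_le_diam_pow _).trans ?_
          rw [Fintype.card_fin]
          refine pow_le_pow_left₀ zero_le (Metric.ediam_le fun c hc c' hc' => ?_) k
          refine le_trans ?_ (Metric.edist_le_ediam_of_mem (s := W) hc.1 hc'.1)
          refine (edist_pi_le_iff.2 fun j => ?_).trans
            (by simpa using PiLp.lipschitzWith_ofLp 2 (fun _ : Fin d => ℝ) (Φ (a, c)) (Φ (a, c')))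
          have := edist_le_pi_edist (Φ (a, c)).ofLp (Φ (a, c')).ofLp (e (Sum.inr j))
          rwa [hΦr, hΦr] at this
        · rw [Set.indicator_of_notMem ha]
          refine le_of_eq (measure_mono_null (fun c hc => ha ?_) measure_empty)
          have := hc.2
          rwa [hbase] at this
    _ = volume K * Metric.ediam W ^ k := by
        rw [lintegral_indicator_const hKm, hKv, mul_comm]

/-- Rotations preserve volume and diameter, so the cylinder may be taken parallel to `E_k`. -/
lemma volume_inter_cylinderAt_le (hk : k ≤ d) (z : BaseSpace d k × MarkSpace d k)
    {W : Set (EuclideanSpace ℝ (Fin d))} (hW : MeasurableSet W) :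
    volume (W ∩ cylinderAt d k z) ≤
      volume (z.2.2 : Set (BaseSpace d k)) * Metric.ediam W ^ k := by
  set ρ := rotationIsometry _ (transpose_mul_of_mem_directions z.2.1.2)
  have hCm : MeasurableSet (cylinderAt d k z) := measurableSet_section measurableSet_mem_cylinderAt z
  have hpre : ρ ⁻¹' (W ∩ cylinderAt d k z) =
      {v | v ∈ ρ ⁻¹' W ∧ baseCoords d k v - z.1 ∈ (z.2.2 : Set (BaseSpace d k))} := by
    ext v
    rw [Set.mem_preimage, Set.mem_inter_iff, mem_cylinderAt_iff]
    change _ ∧ baseCoords d k (ρ.symm (ρ v)) - z.1 ∈ _ ↔ _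
    rw [ρ.symm_apply_apply]
    rfl
  rw [← ρ.measurePreserving.measure_preimage (hW.inter hCm).nullMeasurableSet, hpre]
  refine (volume_cylinder_inter_le hk z.2.2.isCompact.measurableSet z.1
    (ρ.continuous.measurable hW)).trans ?_
  have hdiam : Metric.ediam (ρ ⁻¹' W) ≤ Metric.ediam W := by
    refine Metric.ediam_le fun v hv v' hv' => ?_
    rw [← ρ.isometry.edist_eq]
    exact Metric.edist_le_ediam_of_mem hv hv'
  gcongr

/-- By Fubini: for fixed `v`, the shifts whose cylinder contains `v` form a reflected translate of
the base. -/
lemma lintegral_volume_cylinderAt (m : MarkSpace d k) (W : Set (EuclideanSpace ℝ (Fin d))) :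
    ∫⁻ x : BaseSpace d k, volume.restrict W (cylinderAt d k (x, m)) =
      volume (m.2 : Set (BaseSpace d k)) * volume W := by
  have hm : MeasurableSet {q : BaseSpace d k × EuclideanSpace ℝ (Fin d) |
      q.2 ∈ cylinderAt d k (q.1, m)} :=
    (measurable_snd.prodMk (measurable_fst.prodMk measurable_const))
      (measurableSet_mem_cylinderAt (d := d) (k := k))
  have h1 := Measure.prod_apply (μ := volume) (ν := volume.restrict W) hm
  have h2 := Measure.prod_apply_symm (μ := volume) (ν := volume.restrict W) hm
  have h3 : ∀ v : EuclideanSpace ℝ (Fin d), volume ((fun x : BaseSpace d k => (x, v)) ⁻¹'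
      {q : BaseSpace d k × EuclideanSpace ℝ (Fin d) | q.2 ∈ cylinderAt d k (q.1, m)}) =
      volume (m.2 : Set (BaseSpace d k)) := by
    intro v
    simp only [Set.preimage_ofPred_eq, mem_cylinderAt_iff]
    exact (Measure.measurePreserving_sub_left volume _).measure_preimage
      m.2.isCompact.measurableSet.nullMeasurableSet
  rw [h1] at h2
  refine h2.trans ?_
  simp_rw [h3]
  rw [lintegral_const, Measure.restrict_apply_univ]

end Geometry

/-! ### Bounds under the intensity measure, and the constants. -/

section Volume

variable {d k : ℕ} {γ A : ℝ} {Q : Measure (MarkSpace d k)}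

lemma ae_volume_base_le [IsProbabilityMeasure Q]
    (hA : ∀ᵐ K ∂Q.snd, volume.real (SetLike.coe K : Set (BaseSpace d k)) ≤ A) :
    ∀ᵐ m ∂Q, volume.real (m.2 : Set (BaseSpace d k)) ≤ A :=
  ae_of_ae_map measurable_snd.aemeasurable hA

lemma ae_intensity_volume_base_le [IsProbabilityMeasure Q]
    (hA : ∀ᵐ K ∂Q.snd, volume.real (SetLike.coe K : Set (BaseSpace d k)) ≤ A) :
    ∀ᵐ z ∂intensity d k γ Q, volume.real (z.2.2 : Set (BaseSpace d k)) ≤ A :=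
  Measure.ae_smul_measure (Measure.quasiMeasurePreserving_snd.ae (ae_volume_base_le hA)) _

lemma volume_cylinderAt_real_le (hk : k ≤ d) {z : BaseSpace d k × MarkSpace d k}
    (hz : volume.real (z.2.2 : Set (BaseSpace d k)) ≤ A)
    (W : NonemptyCompacts (EuclideanSpace ℝ (Fin d))) :
    (volume.restrict (W : Set (EuclideanSpace ℝ (Fin d)))).real (cylinderAt d k z) ≤
      A * Metric.diam (W : Set (EuclideanSpace ℝ (Fin d))) ^ k := by
  have hW := W.isCompact.measurableSet
  have h1 := volume_inter_cylinderAt_le hk z hW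
  have h2 : volume (z.2.2 : Set (BaseSpace d k)) * Metric.ediam (W : Set (EuclideanSpace ℝ (Fin d))) ^ k
      ≠ ∞ :=
    ENNReal.mul_ne_top z.2.2.isCompact.measure_lt_top.ne
      (ENNReal.pow_ne_top W.isCompact.isBounded.ediam_ne_top)
  rw [measureReal_restrict_apply' hW, Set.inter_comm]
  refine (ENNReal.toReal_mono h2 h1).trans ?_
  rw [ENNReal.toReal_mul, ENNReal.toReal_pow]
  exact mul_le_mul_of_nonneg_right hz (pow_nonneg Metric.diam_nonneg k)

lemma lintegral_volume_cylinderAt_le [IsProbabilityMeasure Q]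
    (hA : ∀ᵐ K ∂Q.snd, volume.real (SetLike.coe K : Set (BaseSpace d k)) ≤ A)
    (W : Set (EuclideanSpace ℝ (Fin d))) [IsFiniteMeasure (volume.restrict W)] :
    ∫⁻ z, volume.restrict W (cylinderAt d k z) ∂intensity d k γ Q ≤
      ENNReal.ofReal γ * (ENNReal.ofReal A * volume W) := by
  have hm : Measurable fun z => volume.restrict W (cylinderAt d k z) :=
    measurable_measure_prodMk_right measurableSet_mem_cylinderAt
  rw [intensity, lintegral_smul_measure, smul_eq_mul]
  gcongr
  rw [lintegral_prod_symm _ hm.aemeasurable]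
  simp_rw [lintegral_volume_cylinderAt]
  calc _ ≤ ∫⁻ _, ENNReal.ofReal A * volume W ∂Q := by
        refine lintegral_mono_ae ?_
        filter_upwards [ae_volume_base_le hA] with m hm
        gcongr
        rw [← ofReal_measureReal m.2.isCompact.measure_lt_top.ne]
        exact ENNReal.ofReal_le_ofReal hm
    _ = _ := by simp

lemma one_half_le_kappa : 1 / 2 ≤ kappa := by
  have h1 : 1 < √(Real.exp 1) := by
    rw [Real.lt_sqrt zero_le_one]
    simp
  rw [kappa, div_le_div_iff₀ two_pos (by linarith)]
  linarith

lemma tailConst_le_one_half : tailConst ≤ 1 / 2 := by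
  have h1 := one_half_le_kappa
  rw [tailConst, div_le_iff₀ (by linarith)]
  linarith [Real.log_two_lt_d9]

/-- Chernoff's bound has the constant `1/2`, which `tailConst` does not exceed because `κ ≥ 1/2`. -/
lemma exp_neg_sq_div_le_tail {t V : ℝ} (hV : 0 < V) :
    Real.exp (-(t ^ 2 / (2 * V))) ≤ Real.exp (-(tailConst * t ^ 2 / V)) := by
  refine Real.exp_le_exp.2 (neg_le_neg ?_)
  rw [div_le_div_iff₀ hV (by linarith)]
  nlinarith [mul_le_mul_of_nonneg_right tailConst_le_one_half
    (mul_nonneg (sq_nonneg t) hV.le)]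

end Volume

end PoissonCylinder

theorem proposition5p3 (d k : ℕ) (hk : k < d) (γ : ℝ) (hγ : 0 < γ)
    (Q : Measure (MarkSpace d k)) [IsProbabilityMeasure Q]
    {Ω : Type*} [MeasurableSpace Ω] (P : Measure Ω)
    [IsProbabilityMeasure P]
    (η : Ω → Measure (BaseSpace d k × MarkSpace d k))
    (hη : IsPoissonProcess P (intensity d k γ Q) η)
    (A : ℝ)
    -- the volume of the typical base, whose law is the second marginal of `Q`, is at most `A`
    (hA : ∀ᵐ K ∂Q.snd, volume.real (SetLike.coe K : Set (BaseSpace d k)) ≤ A)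
    (W : NonemptyCompacts (EuclideanSpace ℝ (Fin d))) :
    let F : Ω → ℝ := coveredVolume d k η W
    let EF : ℝ := ∫ ω, F ω ∂P
    let D : ℝ := Metric.diam (W : Set (EuclideanSpace ℝ (Fin d)))
    let v : ℝ := volume.real (W : Set (EuclideanSpace ℝ (Fin d)))
    Integrable F P ∧
    ∀ t : ℝ, 4 * √kappa ≤ t →
      P.real {ω | F ω ≥ EF + t} ≤ Real.exp (-(tailConst * t ^ 2 / (A * D ^ k * v))) ∧
      P.real {ω | F ω ≤ EF - t} ≤ Real.exp (-(tailConst * t ^ 2 / (γ * A ^ 2 * D ^ k * v))) ∧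
      -- if the denominators vanish, the bounds are read as `exp (-∞) = 0`
      (A * D ^ k * v = 0 → P.real {ω | F ω ≥ EF + t} = 0 ∧ P.real {ω | F ω ≤ EF - t} = 0) := by
  intro F EF D v
  set w : Set (EuclideanSpace ℝ (Fin d)) := (W : Set (EuclideanSpace ℝ (Fin d)))
  have hwm : MeasurableSet w := W.isCompact.measurableSet
  have hwt : volume w ≠ ∞ := W.isCompact.measure_lt_top.ne
  have : IsFiniteMeasure (volume.restrict w) := ⟨by simpa using hwt.lt_top⟩
  have hA0 : 0 ≤ A := by
    obtain ⟨m, hm⟩ := (ae_volume_base_le hA).exists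
    exact measureReal_nonneg.trans hm
  have hD0 : 0 ≤ D := Metric.diam_nonneg
  have hv0 : 0 ≤ v := measureReal_nonneg
  have hb0 : 0 ≤ A * D ^ k := mul_nonneg hA0 (pow_nonneg hD0 k)
  have hF : F = fun ω => coverage (volume.restrict w) (cylinderAt d k) (η ω) := by
    funext ω
    exact (measureReal_restrict_apply' hwm).symm
  have hvol : (volume.restrict w).real Set.univ = v := measureReal_restrict_apply_univ w
  have hint := lintegral_volume_cylinderAt_le (γ := γ) hA w
  have hfin : ENNReal.ofReal γ * (ENNReal.ofReal A * volume w) ≠ ∞ := by finiteness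
  have hmean : (∫⁻ z, volume.restrict w (cylinderAt d k z) ∂intensity d k γ Q).toReal ≤
      γ * (A * v) := by
    refine (ENNReal.toReal_mono hfin hint).trans (le_of_eq ?_)
    rw [ENNReal.toReal_mul, ENNReal.toReal_mul, ENNReal.toReal_ofReal hγ.le,
      ENNReal.toReal_ofReal hA0]
    rfl
  obtain ⟨hmeas, hmgf⟩ := hη.coverage_mgf_le measurableSet_mem_cylinderAt hb0
    ((ae_intensity_volume_base_le hA).mono fun z hz => volume_cylinderAt_real_le hk.le hz W)
    (ne_top_of_le_ne_top hfin hint)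
  rw [← hF] at hmeas
  have hF0 : ∀ ω, 0 ≤ F ω := fun ω => measureReal_nonneg
  have hFv : ∀ ω, F ω ≤ v := fun ω => measureReal_mono Set.inter_subset_right hwt
  have hup : ∀ s : ℝ, 0 ≤ s →
      ∫ ω, Real.exp (s * F ω) ∂P ≤ Real.exp (s * EF + s ^ 2 * (A * D ^ k * v) / 2) := by
    intro s hs
    have := (hmgf s hs).1
    rw [hvol] at this
    simpa only [EF, hF] using this
  have hlow : ∀ s : ℝ, 0 ≤ s → ∫ ω, Real.exp (s * (-F ω)) ∂P ≤
      Real.exp (s * (-EF) + s ^ 2 * (γ * A ^ 2 * D ^ k * v) / 2) := by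
    intro s hs
    have h1 : ∫ ω, Real.exp (s * (-F ω)) ∂P ≤ Real.exp (s * (-EF) + s ^ 2 * (A * D ^ k *
        (∫⁻ z, volume.restrict w (cylinderAt d k z) ∂intensity d k γ Q).toReal) / 2) := by
      simpa only [EF, hF] using (hmgf s hs).2
    refine h1.trans (Real.exp_le_exp.2 ?_)
    have h2 := mul_le_mul_of_nonneg_left (mul_le_mul_of_nonneg_left hmean hb0) (sq_nonneg s)
    have h3 : s ^ 2 * (A * D ^ k * (γ * (A * v))) = s ^ 2 * (γ * A ^ 2 * D ^ k * v) := by ring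
    linarith
  have hFneg : ∀ ω, -F ω ≤ 0 := fun ω => neg_nonpos.2 (hF0 ω)
  have hset : ∀ t : ℝ, {ω | F ω ≤ EF - t} = {ω | -EF + t ≤ -F ω} := by
    intro t
    ext ω
    constructor <;> intro h <;> simp only [Set.mem_ofPred_eq] at h ⊢ <;> linarith
  refine ⟨Integrable.of_bound hmeas.aestronglyMeasurable v (Filter.Eventually.of_forall fun ω => by
    rw [Real.norm_eq_abs, abs_of_nonneg (hF0 ω)]; exact hFv ω), fun t ht => ?_⟩
  have ht0 : 0 < t := lt_of_lt_of_le
    (mul_pos four_pos (Real.sqrt_pos.2 (by linarith [one_half_le_kappa]))) ht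
  have hV1 : 0 ≤ A * D ^ k * v := mul_nonneg hb0 hv0
  have hV2 : 0 ≤ γ * A ^ 2 * D ^ k * v := by positivity
  rw [hset]
  refine ⟨?_, ?_, fun h0 => ⟨?_, ?_⟩⟩
  · rcases hV1.eq_or_lt with h | h
    -- Division by zero gives 0 here, so the right-hand side is 1 and the bound is trivial; the
    -- degenerate case proper is the last clause.
    · rw [← h]
      simp
    · exact (measureReal_ge_le_exp_of_mgf_le_of_pos hmeas hFv h hup ht0.le).trans
        (exp_neg_sq_div_le_tail h)
  · rcases hV2.eq_or_lt with h | h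
    · rw [← h]
      simp
    · exact (measureReal_ge_le_exp_of_mgf_le_of_pos hmeas.neg hFneg h hlow ht0.le).trans
        (exp_neg_sq_div_le_tail h)
  · exact measureReal_ge_eq_zero_of_mgf_le hmeas hFv h0 hup ht0
  · refine measureReal_ge_eq_zero_of_mgf_le hmeas.neg hFneg ?_ hlow ht0
    calc γ * A ^ 2 * D ^ k * v = γ * A * (A * D ^ k * v) := by ring
      _ = 0 := by rw [h0, mul_zero]
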